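/- Let $X$ be a complex affine irreducible (reduced) variety of dimension $n$ with coordinate ring $\mathcal O(X)$, and let $G$ be a finite group acting on $X$ by automorphisms. Let $X/G$ be the affine variety with coordinate ring $\mathcal O(X)^G$, and suppose that $X/G$ is rational, i.e. for some $m\ge 0$ it is birationally equivalent to $\mathbb A^m(\mathbb C)$ (equivalently, $\operatorname{Frac}(\mathcal O(X)^G)\cong\mathbb C(x_1,\dots,x_m)$ as $\mathbb C$-algebras). Let $D(X)=\bigcup_{i\ge 0}D(X)_i\subseteq \operatorname{End}_{\mathbb C}(\mathcal O(X))$ be the algebra of differential operators on $X$, where $D(X)_0=\mathcal O(X)$ (acting by multiplication) and $D(X)_i=\{d: db-bd\in D(X)_{i-1}\text{ for all }b\in\mathcal O(X)\}$ for $i\ge 1$. Let $A_n(\mathbb C)$ be the $n$-th Weyl algebra, generated over $\mathbb C$ by $x_1,\dots,x_n,\partial_1,\dots,\partial_n$ with relations $x_ix_j=x_jx_i$, $\partial_i\partial_j=\partial_j\partial_i$, $\partial_ix_j-x_j\partial_i=\delta_{ij}$. Then $D(X)$ and $A_n(\mathbb C)$ are (left and right) Ore domains, and there is an isomorphism of $\mathbb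 C$-algebras $$(\operatorname{Frac} D(X))^G\;\cong\; F_n(\mathbb C).$$ Here $\operatorname{Frac}$ denotes the skew field of fractions, $F_n(\mathbb C)=\operatorname{Frac} A_n(\mathbb C)$ is the Weyl field, and $G$ acts on $\operatorname{Frac} D(X)$ by the unique extension of its action $g*d=g\circ d\circ g^{-1}$ on $D(X)$. -/

import Mathlib

open scoped nonZeroDivisors

noncomputable section

section DifferentialOperators

variable (k : Type*) [Field k] (A : Type*) [CommRing A] [Algebra k A]

/-- `diffOpsLE k A n` is the space of `k`-linear differential operators of order at most `n` on the
commutative `k`-algebra `A`: those of order `0` are the multiplications by elements of `A`, and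
`d ∈ End_k A` has order at most `n + 1` when every commutator `d b - b d`, for `b ∈ A`, has order
at most `n`. -/
def diffOpsLE : ℕ → Submodule k (Module.End k A)
  | 0 => LinearMap.range (Algebra.lmul k A).toLinearMap
  | n + 1 =>
    { carrier := {d | ∀ b : A, d * Algebra.lmul k A b - Algebra.lmul k A b * d ∈ diffOpsLE n}
      add_mem' := fun {x y} hx hy b => by
        have h := (diffOpsLE n).add_mem (hx b) (hy b)
        have e : (x + y) * Algebra.lmul k A b - Algebra.lmul k A b * (x + y) =
            (x * Algebra.lmul k A b - Algebra.lmul k A b * x) +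
              (y * Algebra.lmul k A b - Algebra.lmul k A b * y) := by
          noncomm_ring
        rw [e]
        exact h
      zero_mem' := fun b => by simp
      smul_mem' := fun c x hx b => by
        have h := (diffOpsLE n).smul_mem c (hx b)
        rwa [smul_sub, ← smul_mul_assoc, ← mul_smul_comm] at h }

variable {k A}

theorem mem_diffOpsLE_zero {d : Module.End k A} :
    d ∈ diffOpsLE k A 0 ↔ ∃ a : A, Algebra.lmul k A a = d := Iff.rfl

theorem mem_diffOpsLE_succ {n : ℕ} {d : Module.End k A} :
    d ∈ diffOpsLE k A (n + 1) ↔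
      ∀ b : A, d * Algebra.lmul k A b - Algebra.lmul k A b * d ∈ diffOpsLE k A n := Iff.rfl

theorem lmul_commutator (a b : A) :
    Algebra.lmul k A a * Algebra.lmul k A b - Algebra.lmul k A b * Algebra.lmul k A a = 0 := by
  rw [← map_mul, ← map_mul, mul_comm, sub_self]

theorem diffOpsLE_le_succ (n : ℕ) : diffOpsLE k A n ≤ diffOpsLE k A (n + 1) := by
  induction n with
  | zero =>
    rintro d ⟨a, rfl⟩ b
    have h : Algebra.lmul k A a * Algebra.lmul k A b -
        Algebra.lmul k A b * Algebra.lmul k A a ∈ diffOpsLE k A 0 := by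
      rw [lmul_commutator]
      exact zero_mem _
    exact h
  | succ n ih => exact fun d hd b => ih (hd b)

theorem diffOpsLE_mono : Monotone (diffOpsLE k A) := monotone_nat_of_le_succ diffOpsLE_le_succ

theorem diffOpsLE_mul : ∀ (m n : ℕ) {p q : Module.End k A},
    p ∈ diffOpsLE k A m → q ∈ diffOpsLE k A n → p * q ∈ diffOpsLE k A (m + n)
  | 0, 0, _, _, ⟨a, ha⟩, ⟨b, hb⟩ => ⟨a * b, by rw [← ha, ← hb]; exact map_mul (Algebra.lmul k A) a b⟩
  | 0, n + 1, p, q, hp, hq => by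
    intro b
    obtain ⟨a, rfl⟩ := mem_diffOpsLE_zero.1 hp
    have h := diffOpsLE_mul 0 n hp (hq b)
    have e := lmul_commutator (k := k) a b
    have e' : Algebra.lmul k A a * q * Algebra.lmul k A b -
        Algebra.lmul k A b * (Algebra.lmul k A a * q) =
        Algebra.lmul k A a * (q * Algebra.lmul k A b - Algebra.lmul k A b * q) := by
      rw [mul_sub, ← mul_assoc, ← mul_assoc, ← mul_assoc, sub_eq_zero.1 e]
    rw [e']
    exact h
  | m + 1, 0, p, q, hp, hq => by
    intro b
    obtain ⟨a, rfl⟩ := mem_diffOpsLE_zero.1 hq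
    have h := diffOpsLE_mul m 0 (hp b) hq
    have e := lmul_commutator (k := k) a b
    have e' : p * Algebra.lmul k A a * Algebra.lmul k A b -
        Algebra.lmul k A b * (p * Algebra.lmul k A a) =
        (p * Algebra.lmul k A b - Algebra.lmul k A b * p) * Algebra.lmul k A a := by
      rw [sub_mul, mul_assoc, mul_assoc, mul_assoc, sub_eq_zero.1 e]
    rw [e']
    exact h
  | m + 1, n + 1, p, q, hp, hq => by
    intro b
    have h1 := diffOpsLE_mul (m + 1) n hp (hq b)
    have h2 := diffOpsLE_mul m (n + 1) (hp b) hq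
    rw [show m + 1 + n = m + (n + 1) by omega] at h1
    have h := add_mem h1 h2
    have e' : p * q * Algebra.lmul k A b - Algebra.lmul k A b * (p * q) =
        p * (q * Algebra.lmul k A b - Algebra.lmul k A b * q) +
        (p * Algebra.lmul k A b - Algebra.lmul k A b * p) * q := by
      rw [mul_sub, sub_mul, mul_assoc, mul_assoc, mul_assoc]
      abel
    rw [e']
    convert h using 2
    exact (show m + 1 + n = m + (n + 1) by omega)

variable (k A)

/-- The algebra `D(A) ⊆ End_k A` of `k`-linear differential operators on `A`, the union of the
spaces of operators of order at most `n`. -/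
def diffOps : Subalgebra k (Module.End k A) where
  carrier := {d | ∃ n, d ∈ diffOpsLE k A n}
  mul_mem' := fun ⟨m, hm⟩ ⟨n, hn⟩ => ⟨m + n, diffOpsLE_mul m n hm hn⟩
  add_mem' := fun ⟨m, hm⟩ ⟨n, hn⟩ =>
    ⟨max m n, add_mem (diffOpsLE_mono (le_max_left m n) hm) (diffOpsLE_mono (le_max_right m n) hn)⟩
  algebraMap_mem' := fun c => ⟨0, algebraMap k A c, (Algebra.lmul k A).commutes c⟩

variable {k A}

theorem conj_mem_diffOpsLE (σ : A ≃ₐ[k] A) (n : ℕ) {d : Module.End k A}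
    (hd : d ∈ diffOpsLE k A n) : σ.toLinearEquiv.conjAlgEquiv k d ∈ diffOpsLE k A n := by
  have key : ∀ b : A, Algebra.lmul k A b =
      σ.toLinearEquiv.conjAlgEquiv k (Algebra.lmul k A (σ.symm b)) := by
    intro b
    ext x
    simp [LinearEquiv.conjAlgEquiv_apply]
  induction n generalizing d with
  | zero =>
    obtain ⟨a, rfl⟩ := mem_diffOpsLE_zero.1 hd
    exact mem_diffOpsLE_zero.2 ⟨σ a, by rw [key, σ.symm_apply_apply]⟩
  | succ n ih =>
    refine mem_diffOpsLE_succ.2 fun b => ?_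
    have h := ih (hd (σ.symm b))
    rwa [map_sub, map_mul, map_mul, ← key] at h

theorem conj_mem_diffOps (σ : A ≃ₐ[k] A) {d : Module.End k A} (hd : d ∈ diffOps k A) :
    σ.toLinearEquiv.conjAlgEquiv k d ∈ diffOps k A :=
  let ⟨n, hn⟩ := hd
  ⟨n, conj_mem_diffOpsLE σ n hn⟩

/-- The automorphism `d ↦ σ ∘ d ∘ σ⁻¹` of `D(A)` induced by an automorphism `σ` of `A`. -/
def diffOpsConj (σ : A ≃ₐ[k] A) : diffOps k A ≃ₐ[k] diffOps k A :=
  AlgEquiv.ofAlgHom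
    (((σ.toLinearEquiv.conjAlgEquiv k).toAlgHom.comp (diffOps k A).val).codRestrict (diffOps k A)
      fun d => conj_mem_diffOps σ d.2)
    (((σ.symm.toLinearEquiv.conjAlgEquiv k).toAlgHom.comp (diffOps k A).val).codRestrict
      (diffOps k A) fun d => conj_mem_diffOps σ.symm d.2)
    (by
      ext d x
      change σ (σ.symm ((d : Module.End k A) (σ (σ.symm x)))) = (d : Module.End k A) x
      simp)
    (by
      ext d x
      change σ.symm (σ ((d : Module.End k A) (σ.symm (σ x)))) = (d : Module.End k A) x
      simp)

theorem diffOpsConj_apply (σ : A ≃ₐ[k] A) (d : diffOps k A) (x : A) :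
    (diffOpsConj σ d : Module.End k A) x = σ ((d : Module.End k A) (σ.symm x)) := rfl

end DifferentialOperators

section SkewFieldOfFractions

/-- A (left and right) Ore domain. -/
class IsOreDomain (R : Type*) [Ring R] : Prop extends IsDomain R where
  left_ore : ∀ a s : R, s ≠ 0 → ∃ b t : R, t ≠ 0 ∧ t * a = b * s
  right_ore : ∀ a s : R, s ≠ 0 → ∃ b t : R, t ≠ 0 ∧ a * t = s * b

instance oreSetOfIsOreDomain (R : Type*) [Ring R] [IsOreDomain R] : OreLocalization.OreSet R⁰ :=
  (OreLocalization.nonempty_oreSet_iff_of_noZeroDivisors.2 fun r s => by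
    obtain ⟨b, t, ht, h⟩ := IsOreDomain.left_ore r s (nonZeroDivisors.ne_zero s.2)
    exact ⟨b, ⟨t, mem_nonZeroDivisors_of_ne_zero ht⟩, h⟩).some

/-- The skew field of fractions `Frac R` of an Ore domain `R`: Mathlib's Ore localization at the
nonzero elements, a division ring. -/
abbrev SkewFrac (R : Type*) [Ring R] [IsOreDomain R] : Type _ := OreLocalization R⁰ R

variable {k R : Type*} [Field k] [Ring R] [Algebra k R] [IsOreDomain R]

theorem numerator_map_ne_zero (φ : R ≃ₐ[k] R) (s : R⁰) :
    (OreLocalization.numeratorRingHom (φ s) : SkewFrac R) ≠ 0 := by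
  intro h
  have hinj := OreLocalization.numeratorHom_inj (R := R) (S := R⁰) inf_le_left
  have h0 : φ (s : R) = 0 := hinj (h.trans (map_zero OreLocalization.numeratorRingHom).symm)
  exact nonZeroDivisors.ne_zero s.2 ((map_eq_zero_iff φ φ.injective).1 h0)

/-- The nonzero elements of `R`, mapped by `φ` into the units of `Frac R`. -/
def numeratorMapUnits (φ : R ≃ₐ[k] R) : R⁰ →* (SkewFrac R)ˣ where
  toFun s := Units.mk0 (OreLocalization.numeratorRingHom (φ s)) (numerator_map_ne_zero φ s)
  map_one' := Units.ext <| by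
    change OreLocalization.numeratorRingHom (φ (1 : R)) = (1 : SkewFrac R)
    rw [map_one, map_one]
  map_mul' s t := Units.ext <| by
    change OreLocalization.numeratorRingHom (φ ((s : R) * t)) =
      (OreLocalization.numeratorRingHom (φ s) * OreLocalization.numeratorRingHom (φ t) : SkewFrac R)
    rw [map_mul, map_mul]

/-- The extension to `Frac R` of an automorphism `φ` of the Ore domain `R`, sending a fraction
`s⁻¹ r` to `φ(s)⁻¹ φ(r)`. -/
def skewFracMap (φ : R ≃ₐ[k] R) : SkewFrac R →ₐ[k] SkewFrac R where
  __ := OreLocalization.universalHom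
    ((OreLocalization.numeratorRingHom (S := R⁰)).comp (φ : R →+* R)) (numeratorMapUnits φ)
    (fun _ => rfl)
  commutes' c := by
    refine Eq.trans (OreLocalization.universalHom_commutes
      ((OreLocalization.numeratorRingHom (S := R⁰)).comp (φ : R →+* R)) (numeratorMapUnits φ)
      (fun _ => rfl) (r := algebraMap k R c)) ?_
    change OreLocalization.numeratorRingHom (S := R⁰) (φ (algebraMap k R c)) = _
    rw [φ.commutes]
    rfl

theorem skewFracMap_numerator (φ : R ≃ₐ[k] R) (r : R) :
    skewFracMap φ (OreLocalization.numeratorRingHom r) =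
      OreLocalization.numeratorRingHom (S := R⁰) (φ r) :=
  OreLocalization.universalHom_commutes _ _ _

end SkewFieldOfFractions

section Invariants

variable (k A G : Type*) [Field k] [CommRing A] [Algebra k A]
  [Group G] [MulSemiringAction G A] [SMulCommClass G k A]

/-- The invariants `(Frac D(A))^G`, where `G` acts on `A` by automorphisms, hence on `D(A)` by
`g * d = g ∘ d ∘ g⁻¹`, hence on `Frac D(A)`. -/
def fracDiffOpsInvariants [IsOreDomain (diffOps k A)] : Subalgebra k (SkewFrac (diffOps k A)) :=
  ⨅ g : G, AlgHom.equalizer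
    (skewFracMap (diffOpsConj (MulSemiringAction.toAlgEquiv k A g)))
    (AlgHom.id k (SkewFrac (diffOps k A)))

theorem mem_fracDiffOpsInvariants [IsOreDomain (diffOps k A)] (q : SkewFrac (diffOps k A)) :
    q ∈ fracDiffOpsInvariants k A G ↔
      ∀ g : G, skewFracMap (diffOpsConj (MulSemiringAction.toAlgEquiv k A g)) q = q := by
  simp [fracDiffOpsInvariants, Algebra.mem_iInf, AlgHom.mem_equalizer]

end Invariants

section Weyl

/-- The defining relations of the `n`-th Weyl algebra: `Sum.inl i` indexes the generator `x_i` and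
`Sum.inr i` the generator `∂_i`. -/
inductive WeylRel (k : Type*) [Field k] (n : ℕ) :
    FreeAlgebra k (Fin n ⊕ Fin n) → FreeAlgebra k (Fin n ⊕ Fin n) → Prop
  | x_comm (i j : Fin n) : WeylRel k n
      (FreeAlgebra.ι k (Sum.inl i) * FreeAlgebra.ι k (Sum.inl j))
      (FreeAlgebra.ι k (Sum.inl j) * FreeAlgebra.ι k (Sum.inl i))
  | d_comm (i j : Fin n) : WeylRel k n
      (FreeAlgebra.ι k (Sum.inr i) * FreeAlgebra.ι k (Sum.inr j))
      (FreeAlgebra.ι k (Sum.inr j) * FreeAlgebra.ι k (Sum.inr i))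
  | d_x (i j : Fin n) : WeylRel k n
      (FreeAlgebra.ι k (Sum.inr i) * FreeAlgebra.ι k (Sum.inl j) -
        FreeAlgebra.ι k (Sum.inl j) * FreeAlgebra.ι k (Sum.inr i))
      (if i = j then 1 else 0)

/-- The `n`-th Weyl algebra `A_n(k)`. -/
abbrev WeylAlgebra (k : Type*) [Field k] (n : ℕ) : Type _ := RingQuot (WeylRel k n)

/-- The Weyl field `F_n(k)`, the skew field of fractions of `A_n(k)`. -/
abbrev WeylField (k : Type*) [Field k] (n : ℕ) [IsOreDomain (WeylAlgebra k n)] : Type _ :=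
  SkewFrac (WeylAlgebra k n)

end Weyl

/-- The irreducible affine variety over `k` with coordinate ring `A` is rational: for some `m` it is
birationally equivalent to affine `m`-space, that is, its function field is isomorphic over `k` to
the field of rational functions `k(x_1, …, x_m)`. -/
def IsRationalVariety (k A : Type*) [Field k] [CommRing A] [IsDomain A] [Algebra k A] : Prop :=
  ∃ m : ℕ, Nonempty (FractionRing A ≃ₐ[k] FractionRing (MvPolynomial (Fin m) k))

end

/-!
Write `K` for the fraction field of `A`, on which `G` acts with fixed field `L = Frac (A^G)`, and
suppose that `L` is the field of rational functions in `x_1, …, x_n`; the number of variables is the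
dimension of `A` because `K` is algebraic over `L`. In characteristic zero `K` is formally étale
over the polynomial ring, so the `x_i` are coordinates on `K`: there are derivations `∂_i` of `K`
with `∂_i x_j = δ_ij`, and a derivation killing all `x_i` is zero (`exists_isDualCoordinates`). The `x_i`
and the `∂_i` generate a copy of the Weyl algebra inside `D(K)`. As the `x_i` are `G`-invariant and
determine the `∂_i`, this copy consists of `G`-invariant operators.

Conversely, by induction on the order with the help of the Euler operator `d ↦ ∑ [d, x_i] ∂_i`,
every operator in `D(K)` is a polynomial in the `∂_i` with coefficients in `K`
(`IsCanonicalPair.xOrderLE_le`). Averaging over the group therefore moves the coefficients of an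
operator into `L`, and a polynomial multiple of the average lies in the Weyl algebra
(`IsDualCoordinates.exists_mul_diffOpsTrace_eq`). If `q = s⁻¹ r` is an invariant fraction, then
`q = (tr s)⁻¹ (tr r)` provided that `tr s ≠ 0`, which independence of characters achieves after
scaling `s` and `r` by an element of `K` (`exists_diffOpsTrace_ne_zero`). Hence the invariants of
`Frac D(K)` are the fractions of the Weyl algebra
(`IsDualCoordinates.exists_skewFracHom_eq_iff`).

Passing from `K` back to `A` costs nothing: operators on `A` extend uniquely to `K`
(`diffOpsExtend`), and, `A` being finitely generated, every operator on `K` becomes an operator on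
`A` after multiplication by a nonzero element of `A` (`exists_mulOp_mul_eq_diffOpsExtend`), so that
`Frac D(A) = Frac D(K)` equivariantly.

For the Ore property of `D(K)`, commutators with the `x_i` are locally nilpotent derivations, which
excludes zero divisors, and the operators of order at most `m` form a `K`-space whose dimension is
polynomial in `m`, which forces common multiples (`IsCanonicalPair.isOreDomain`). The property
descends to `D(A)`, and to the Weyl algebra, which is `D` of the polynomial ring (`weylEquiv`).
-/

noncomputable section

/-! ### Commutators in an associative algebra -/

section Bracket

variable (k : Type*) {R : Type*} [Field k] [Ring R] [Algebra k R]

/-- The inner derivation `d ↦ d a - a d`. -/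
def bracketRight (a : R) : R →ₗ[k] R := LinearMap.mulRight k a - LinearMap.mulLeft k a

variable {k}

theorem bracketRight_apply (a d : R) : bracketRight k a d = d * a - a * d := rfl

theorem bracketRight_mul (a d e : R) :
    bracketRight k a (d * e) = bracketRight k a d * e + d * bracketRight k a e := by
  simp only [bracketRight_apply]; noncomm_ring

theorem bracketRight_comm {a b : R} (h : a * b = b * a) (d : R) :
    bracketRight k a (bracketRight k b d) = bracketRight k b (bracketRight k a d) := by
  simp only [bracketRight_apply, sub_mul, mul_sub, mul_assoc, h]
  simp only [← mul_assoc, h]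
  abel

/-- The top term of Leibniz' rule: if `p` and `q` are the last exponents for which iterated
commutators of `d` and `e` may survive, only one term of the expansion remains. -/
theorem bracketRight_iterate_mul (a : R) :
    ∀ (N p q : ℕ) (d e : R), p + q = N → (bracketRight k a)^[p + 1] d = 0 →
      (bracketRight k a)^[q + 1] e = 0 →
      (bracketRight k a)^[N] (d * e) =
        N.choose p • ((bracketRight k a)^[p] d * (bracketRight k a)^[q] e) := by
  have hz : ∀ n, (bracketRight k a)^[n] 0 = 0 := fun n => iterate_map_zero (bracketRight k a) n
  intro N
  induction N with
  | zero =>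
    intro p q d e h _ _
    obtain ⟨rfl, rfl⟩ : p = 0 ∧ q = 0 := by omega
    simp
  | succ N ih =>
    intro p q d e h hd he
    have hadd : ∀ u v, (bracketRight k a)^[N] (u + v) =
      (bracketRight k a)^[N] u + (bracketRight k a)^[N] v := iterate_map_add (bracketRight k a) N
    rw [Function.iterate_succ_apply, bracketRight_mul, hadd]
    rw [Function.iterate_succ_apply] at hd he
    rcases p with _ | p
    · rcases q with _ | q
      · omega
      · rw [ih 0 q d (bracketRight k a e) (by omega) hd he]
        have hd' : bracketRight k a d = 0 := hd
        simp [hd', hz]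
    · rw [ih p q (bracketRight k a d) e (by omega) hd (by rwa [Function.iterate_succ_apply])]
      rcases q with _ | q
      · have he' : bracketRight k a e = 0 := he
        obtain rfl : N = p := by omega
        simp [he', hz]
      · rw [ih (p + 1) q d (bracketRight k a e) (by omega)
          (by rwa [Function.iterate_succ_apply]) he, Nat.choose_succ_succ, add_smul,
          Function.iterate_succ_apply, Function.iterate_succ_apply]

/-- If the iterated commutators of `d` with `f` vanish, then `d f^N ∈ f R`: a factor `f`
can be moved from the right of `d` to its left. -/
theorem exists_mul_pow_eq_mul (f : R) :
    ∀ (N : ℕ) (d : R), (bracketRight k f)^[N] d = 0 → ∃ e, d * f ^ N = f * e := by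
  intro N
  induction N with
  | zero => exact fun d h => ⟨0, by simpa using h⟩
  | succ N ih =>
    intro d h
    rw [Function.iterate_succ_apply] at h
    obtain ⟨e, h'⟩ := ih (bracketRight k f d) h
    refine ⟨d * f ^ N + e, ?_⟩
    rw [mul_add, ← h', bracketRight_apply, pow_succ']
    noncomm_ring

end Bracket

/-! ### Canonical pairs and the order filtration -/

/-- A family `x_i, y_i` of elements of a ring satisfying the canonical commutation relations
`[x_i, x_j] = [y_i, y_j] = 0` and `[y_i, x_j] = δ_ij`. -/
structure IsCanonicalPair {ι R : Type*} [DecidableEq ι] [Ring R] (x y : ι → R) : Prop where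
  x_comm : ∀ i j, x i * x j = x j * x i
  y_comm : ∀ i j, y i * y j = y j * y i
  y_x : ∀ i j, y i * x j - x j * y i = if i = j then 1 else 0

theorem IsCanonicalPair.op {ι R : Type*} [DecidableEq ι] [Ring R] {x y : ι → R}
    (h : IsCanonicalPair x y) :
    IsCanonicalPair (fun i => MulOpposite.op (x i)) (fun i => MulOpposite.op (-y i)) where
  x_comm i j := by rw [← MulOpposite.op_mul, ← MulOpposite.op_mul, h.x_comm]
  y_comm i j := by
    rw [← MulOpposite.op_mul, ← MulOpposite.op_mul, neg_mul_neg, neg_mul_neg, h.y_comm]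
  y_x i j := by
    rw [← MulOpposite.op_mul, ← MulOpposite.op_mul, ← MulOpposite.op_sub]
    have := h.y_x i j
    rw [show x j * -y i - -y i * x j = y i * x j - x j * y i by noncomm_ring, this]
    split_ifs <;> simp

section XOrder

variable (k : Type*) {ι R : Type*} [Field k] [Ring R] [Algebra k R] (x : ι → R)

/-- The elements of order at most `m` relative to the family `x`: for `m = 0` the centralizer of
the `x_i`, and for `m + 1` those whose commutators with all `x_i` have order at most `m`. -/
def xOrderLE : ℕ → Submodule k R
  | 0 => ⨅ i, LinearMap.ker (bracketRight k (x i))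
  | m + 1 => ⨅ i, (xOrderLE m).comap (bracketRight k (x i))

variable {k x}

theorem mem_xOrderLE_zero {d : R} : d ∈ xOrderLE k x 0 ↔ ∀ i, bracketRight k (x i) d = 0 := by
  simp [xOrderLE]

theorem mem_xOrderLE_succ {m : ℕ} {d : R} :
    d ∈ xOrderLE k x (m + 1) ↔ ∀ i, bracketRight k (x i) d ∈ xOrderLE k x m := by
  simp [xOrderLE]

theorem xOrderLE_mono : Monotone (xOrderLE k x) := by
  refine monotone_nat_of_le_succ fun m => ?_
  induction m with
  | zero =>
    intro d hd
    rw [mem_xOrderLE_zero] at hd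
    exact mem_xOrderLE_succ.2 fun i => by rw [hd]; exact zero_mem _
  | succ m ih => exact fun d hd => mem_xOrderLE_succ.2 fun i => ih (mem_xOrderLE_succ.1 hd i)

theorem one_mem_xOrderLE : (1 : R) ∈ xOrderLE k x 0 :=
  mem_xOrderLE_zero.2 fun i => by simp [bracketRight_apply]

theorem mul_mem_xOrderLE {m n : ℕ} {d e : R} (hd : d ∈ xOrderLE k x m)
    (he : e ∈ xOrderLE k x n) : d * e ∈ xOrderLE k x (m + n) := by
  generalize hN : m + n = N
  induction N generalizing m n d e with
  | zero =>
    obtain ⟨rfl, rfl⟩ : m = 0 ∧ n = 0 := by omega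
    rw [mem_xOrderLE_zero] at *
    intro i
    rw [bracketRight_mul, hd, he]
    simp
  | succ N ih =>
    refine mem_xOrderLE_succ.2 fun i => ?_
    rw [bracketRight_mul]
    refine add_mem ?_ ?_
    · rcases m with _ | m
      · rw [mem_xOrderLE_zero.1 hd, zero_mul]; exact zero_mem _
      · exact ih (mem_xOrderLE_succ.1 hd i) he (by omega)
    · rcases n with _ | n
      · rw [mem_xOrderLE_zero.1 he, mul_zero]; exact zero_mem _
      · exact ih hd (mem_xOrderLE_succ.1 he i) (by omega)

theorem bracketRight_iterate_eq_zero (i : ι) {m : ℕ} {d : R} (hd : d ∈ xOrderLE k x m) :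
    (bracketRight k (x i))^[m + 1] d = 0 := by
  induction m generalizing d with
  | zero => exact mem_xOrderLE_zero.1 hd i
  | succ m ih =>
    rw [Function.iterate_succ_apply]
    exact ih (mem_xOrderLE_succ.1 hd i)

theorem mem_xOrderLE_op {d : R} {m : ℕ} (hd : d ∈ xOrderLE k x m) :
    MulOpposite.op d ∈ xOrderLE k (fun i => MulOpposite.op (x i)) m := by
  have key : ∀ (i) (d : R), bracketRight k (MulOpposite.op (x i)) (MulOpposite.op d) =
      MulOpposite.op (-bracketRight k (x i) d) := by
    intro i d
    rw [bracketRight_apply, bracketRight_apply, ← MulOpposite.op_mul, ← MulOpposite.op_mul,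
      ← MulOpposite.op_sub, neg_sub]
  induction m generalizing d with
  | zero =>
    exact mem_xOrderLE_zero.2 fun i => by rw [key, mem_xOrderLE_zero.1 hd]; simp
  | succ m ih =>
    exact mem_xOrderLE_succ.2 fun i => by
      rw [key]; exact ih (neg_mem (mem_xOrderLE_succ.1 hd i))

end XOrder

/-! ### Absence of zero divisors -/

section NoZeroDivisors

variable {k ι R : Type*} [Field k] [CharZero k] [Ring R] [Algebra k R] [Finite ι] {x : ι → R}

/-- A ring which is exhausted by the order filtration relative to commuting elements `x_i` has no
zero divisors as soon as the centralizer of the `x_i` has none: the commutators with the `x_i` are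
locally nilpotent derivations, and by Leibniz' rule the last nonvanishing iterates multiply. -/
theorem noZeroDivisors_of_xOrderLE (hx : ∀ i j, x i * x j = x j * x i)
    (hexh : ∀ d : R, ∃ m, d ∈ xOrderLE k x m)
    (hcent : ∀ d ∈ xOrderLE k x 0, ∀ e ∈ xOrderLE k x 0, d * e = 0 → d = 0 ∨ e = 0) :
    NoZeroDivisors R := by
  classical
  have := Fintype.ofFinite ι
  have key : ∀ (S : Finset ι) (d e : R), (∀ i ∉ S, bracketRight k (x i) d = 0) →
      (∀ i ∉ S, bracketRight k (x i) e = 0) → d * e = 0 → d = 0 ∨ e = 0 := by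
    intro S
    induction S using Finset.induction_on with
    | empty =>
      intro d e hd he
      exact hcent d (mem_xOrderLE_zero.2 fun i => hd i (by simp)) e
        (mem_xOrderLE_zero.2 fun i => he i (by simp))
    | insert i S hi ih =>
      intro d e hd he hde
      have hcomm : ∀ (j) (n : ℕ) (d : R), bracketRight k (x j) d = 0 →
          bracketRight k (x j) ((bracketRight k (x i))^[n] d) = 0 := by
        intro j n
        induction n with
        | zero => exact fun d h => h
        | succ n ihn =>
          intro d h
          rw [Function.iterate_succ_apply]
          exact ihn _ (by rw [bracketRight_comm (hx j i), h, map_zero])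
      -- The last nonvanishing iterated commutator with `x_i`.
      have hlast : ∀ d : R, d ≠ 0 → (∀ j ∉ insert i S, bracketRight k (x j) d = 0) →
          ∃ p, (bracketRight k (x i))^[p] d ≠ 0 ∧ (bracketRight k (x i))^[p + 1] d = 0 ∧
            ∀ j ∉ S, bracketRight k (x j) ((bracketRight k (x i))^[p] d) = 0 := by
        intro d hd0 hd
        have hex : ∃ m, (bracketRight k (x i))^[m + 1] d = 0 := by
          obtain ⟨m, hm⟩ := hexh d
          exact ⟨m, bracketRight_iterate_eq_zero i hm⟩
        refine ⟨Nat.find hex, ?_, Nat.find_spec hex, fun j hj => ?_⟩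
        · rcases h : Nat.find hex with _ | m
          · exact hd0
          · exact Nat.find_min hex (by omega : m < Nat.find hex)
        · by_cases hji : j = i
          · subst hji
            rw [← Function.iterate_succ_apply' (bracketRight k (x j))]
            exact Nat.find_spec hex
          · exact hcomm j _ d (hd j (by simp [hji, hj]))
      by_contra! hne
      obtain ⟨p, hp0, hp1, hpc⟩ := hlast d hne.1 hd
      obtain ⟨q, hq0, hq1, hqc⟩ := hlast e hne.2 he
      have h := bracketRight_iterate_mul (x i) (p + q) p q d e rfl hp1 hq1
      have hchoose : ((p + q).choose p : k) ≠ 0 :=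
        Nat.cast_ne_zero.2 (Nat.choose_pos (by omega)).ne'
      rw [hde, iterate_map_zero, ← Nat.cast_smul_eq_nsmul k, eq_comm,
        smul_eq_zero_iff_right hchoose] at h
      rcases ih _ _ hpc hqc h with h | h
      · exact hp0 h
      · exact hq0 h
  exact ⟨fun {d e} h => key Finset.univ d e (by simp) (by simp) h⟩

end NoZeroDivisors

/-! ### The Euler operator -/

section Euler

variable {k ι R : Type*} [Field k] [Ring R] [Algebra k R] {x y : ι → R}

theorem IsCanonicalPair.bracketRight_y [DecidableEq ι] (h : IsCanonicalPair x y) (i j : ι) :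
    bracketRight k (x j) (y i) = if i = j then 1 else 0 := h.y_x i j

variable [Fintype ι]

variable (k) in
/-- The Euler operator `d ↦ ∑ i, [d, x_i] y_i`. It multiplies `∑_{|α| = m} c_α y^α`, with `c_α`
commuting with the `x_i`, by `m`. -/
def eulerOp (x y : ι → R) : R →ₗ[k] R :=
  ∑ i, (LinearMap.mulRight k (y i)).comp (bracketRight k (x i))

theorem eulerOp_apply (x y : ι → R) (d : R) :
    eulerOp k x y d = ∑ i, bracketRight k (x i) d * y i := by
  simp [eulerOp]

variable [DecidableEq ι]

theorem IsCanonicalPair.bracketRight_eulerOp (h : IsCanonicalPair x y) (j : ι) (d : R) :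
    bracketRight k (x j) (eulerOp k x y d) =
      eulerOp k x y (bracketRight k (x j) d) + bracketRight k (x j) d := by
  simp only [eulerOp_apply, map_sum, bracketRight_mul, h.bracketRight_y, Finset.sum_add_distrib]
  congr 1
  · exact Finset.sum_congr rfl fun i _ => by rw [bracketRight_comm (h.x_comm j i)]
  · simp

/-- The Euler operator acts as `m + 1` on elements of order `m + 1`, up to lower order. -/
theorem IsCanonicalPair.eulerOp_sub_mem (h : IsCanonicalPair x y) (m : ℕ) {d : R}
    (hd : d ∈ xOrderLE k x (m + 1)) :
    eulerOp k x y d - (m + 1 : k) • d ∈ xOrderLE k x m := by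
  induction m generalizing d with
  | zero =>
    refine mem_xOrderLE_zero.2 fun j => ?_
    have hj := mem_xOrderLE_zero.1 (mem_xOrderLE_succ.1 hd j)
    rw [map_sub, h.bracketRight_eulerOp, eulerOp_apply, map_smul]
    simp [hj]
  | succ m ih =>
    refine mem_xOrderLE_succ.2 fun j => ?_
    have := ih (mem_xOrderLE_succ.1 hd j)
    rw [map_sub, h.bracketRight_eulerOp, map_smul]
    convert this using 1
    push_cast
    module

/-- Elements of order at most `m` relative to the `x_i` are polynomials of degree at most `m` in the
`y_i` with coefficients in the centralizer of the `x_i`; here `U m` stands for any filtration which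
contains these. The Euler operator allows to argue by induction on `m`. -/
theorem IsCanonicalPair.xOrderLE_le [CharZero k] (h : IsCanonicalPair x y)
    {U : ℕ → Submodule k R} (hU : Monotone U) (h0 : xOrderLE k x 0 ≤ U 0)
    (hy : ∀ m, ∀ u ∈ U m, ∀ i, u * y i ∈ U (m + 1)) (m : ℕ) : xOrderLE k x m ≤ U m := by
  induction m with
  | zero => exact h0
  | succ m ih =>
    intro d hd
    have h1 : eulerOp k x y d ∈ U (m + 1) := by
      rw [eulerOp_apply]
      exact sum_mem fun i _ => hy m _ (ih (mem_xOrderLE_succ.1 hd i)) i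
    have h2 := sub_mem h1 (hU (Nat.le_succ m) (ih (h.eulerOp_sub_mem m hd)))
    rw [sub_sub_cancel] at h2
    have hm : (m + 1 : k) ≠ 0 := by exact_mod_cast Nat.succ_ne_zero m
    exact (Submodule.smul_mem_iff _ hm).1 h2

end Euler

/-! ### Growth and common multiples -/

open scoped IsMulCommutative in
/-- A commuting family in a `k`-algebra defines an algebra homomorphism from polynomials. -/
theorem exists_mvPolynomial_algHom {k ι R : Type*} [Field k] [Ring R] [Algebra k R] (y : ι → R)
    (h : ∀ i j, y i * y j = y j * y i) :
    ∃ φ : MvPolynomial ι k →ₐ[k] R, ∀ i, φ (MvPolynomial.X i) = y i := by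
  let S := Algebra.adjoin k (Set.range y)
  have : IsMulCommutative S := Algebra.isMulCommutative_adjoin k (by
    rintro _ ⟨i, rfl⟩ _ ⟨j, rfl⟩
    exact h i j)
  let φ : MvPolynomial ι k →ₐ[k] S :=
    MvPolynomial.aeval fun i => ⟨y i, Algebra.subset_adjoin ⟨i, rfl⟩⟩
  refine ⟨S.val.comp φ, fun i => ?_⟩
  rw [AlgHom.comp_apply, MvPolynomial.aeval_X]
  rfl

section Growth

variable {K E : Type*} [Field K] [Ring E] [Module K E] [IsScalarTower K E E]

/-- Polynomial growth forces common left multiples: otherwise `(u, v) ↦ u a - v s` is injective, and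
the dimension of the filtration doubles at every step of a fixed length. -/
theorem exists_common_left_multiple_of_growth (V : ℕ → Submodule K E)
    [∀ m, FiniteDimensional K (V m)] (hV : Monotone V) (h1 : V 0 ≠ ⊥) (N : ℕ)
    (hN : ∀ m, Module.finrank K (V m) ≤ (m + 1) ^ N)
    (hmul : ∀ e : E, ∃ q, ∀ m, ∀ v ∈ V m, v * e ∈ V (m + q)) (a s : E) :
    ∃ u v : E, (u ≠ 0 ∨ v ≠ 0) ∧ u * a = v * s := by
  by_contra! hcon
  obtain ⟨q₁, hq₁⟩ := hmul a
  obtain ⟨q₂, hq₂⟩ := hmul s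
  set q := q₁ + q₂ with hq
  have step : ∀ m, 2 * Module.finrank K (V m) ≤ Module.finrank K (V (m + q)) := by
    intro m
    let f : (V m × V m) →ₗ[K] V (m + q) :=
      { toFun := fun p => ⟨(p.1 : E) * a - (p.2 : E) * s, sub_mem
          (hV (by omega) (hq₁ m _ p.1.2)) (hV (by omega) (hq₂ m _ p.2.2))⟩
        map_add' := fun p p' => Subtype.ext (by
          simp only [Prod.fst_add, Prod.snd_add, Submodule.coe_add, add_mul]; abel)
        map_smul' := fun c p => Subtype.ext (by
          simp [smul_sub, smul_mul_assoc]) }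
    have hf : Function.Injective f := by
      rw [injective_iff_map_eq_zero]
      rintro ⟨u, v⟩ huv
      have huv' : (u : E) * a = (v : E) * s := sub_eq_zero.1 (congrArg Subtype.val huv)
      by_contra hne
      refine hcon u v ?_ huv'
      by_contra! h0
      exact hne (Prod.ext (Subtype.ext h0.1) (Subtype.ext h0.2))
    have := LinearMap.finrank_le_finrank_of_injective hf
    rw [Module.finrank_prod] at this
    omega
  have hpos : 0 < Module.finrank K (V 0) := by
    rw [Nat.pos_iff_ne_zero, Ne, Submodule.finrank_eq_zero]
    exact h1
  have hpow : ∀ j : ℕ, 2 ^ j ≤ Module.finrank K (V (j * q)) := by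
    intro j
    induction j with
    | zero => rw [Nat.zero_mul, pow_zero]; exact hpos
    | succ j ih =>
      have := step (j * q)
      rw [show j * q + q = (j + 1) * q by ring] at this
      rw [pow_succ]
      omega
  have hlim := tendsto_pow_const_div_const_pow_of_one_lt N (one_lt_two : (1 : ℝ) < 2)
  have hC : (0 : ℝ) < 1 / ((q + 1 : ℕ) : ℝ) ^ N := by positivity
  -- `2 ^ j` outgrows the bound `(j q + 1) ^ N ≤ (j (q + 1)) ^ N`.
  obtain ⟨j, hj, hj1⟩ := ((hlim.eventually (gt_mem_nhds hC)).and
    (Filter.eventually_ge_atTop 1)).exists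
  have h2 : ((2 ^ j : ℕ) : ℝ) ≤ (((q + 1) * j) ^ N : ℕ) := by
    refine Nat.cast_le.2 ((hpow j).trans ((hN _).trans (Nat.pow_le_pow_left ?_ N)))
    nlinarith
  rw [div_lt_div_iff₀ (by positivity) (by positivity)] at hj
  push_cast at h2 hj
  rw [mul_pow] at h2
  linarith

end Growth

section Ore

variable {k ι K E : Type*} [Field k] [CharZero k] [Field K] [Algebra k K] [Ring E] [Algebra k E]
  [DecidableEq ι] [Fintype ι] {x y : ι → E}

/-- If `E` is exhausted by the order filtration of a canonical pair and the centralizer of the `x_i`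
is a field, then any two elements of `E` have a nontrivial common left multiple. -/
theorem IsCanonicalPair.exists_common_left_multiple [Nontrivial E] (h : IsCanonicalPair x y)
    (κ : K →ₐ[k] E)
    (hκ : ∀ c i, κ c * x i = x i * κ c) (hcent : ∀ d ∈ xOrderLE k x 0, ∃ c, κ c = d)
    (hexh : ∀ d : E, ∃ m, d ∈ xOrderLE k x m) (a s : E) :
    ∃ u v : E, (u ≠ 0 ∨ v ≠ 0) ∧ u * a = v * s := by
  let _ : Module K E := Module.compHom E κ.toRingHom
  have smul_def' : ∀ (c : K) (e : E), c • e = κ c * e := fun _ _ => rfl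
  have : IsScalarTower K E E := ⟨fun c d e => by
    simp only [smul_def', smul_eq_mul, mul_assoc]⟩
  have : IsScalarTower k K E := ⟨fun c z e => by simp [smul_def']⟩
  have hκ0 : ∀ c, κ c ∈ xOrderLE k x 0 := fun c =>
    mem_xOrderLE_zero.2 fun i => by rw [bracketRight_apply, hκ, sub_self]
  let V : ℕ → Submodule K E := fun m =>
    { (xOrderLE k x m).toAddSubmonoid with
      smul_mem' := fun c d hd => by
        have := mul_mem_xOrderLE (hκ0 c) hd
        rwa [zero_add] at this }
  obtain ⟨φ, hφ⟩ := exists_mvPolynomial_algHom (k := k) y h.y_comm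
  let T : (m : ℕ) → (ι → Fin (m + 1)) → E := fun m β =>
    φ (MvPolynomial.monomial (Finsupp.equivFunOnFinite.symm fun i => (β i : ℕ)) 1)
  let U : ℕ → Submodule K E := fun m =>
    Submodule.span K {e | ∃ β : ι →₀ ℕ, β.degree ≤ m ∧ φ (MvPolynomial.monomial β 1) = e}
  have hVU : ∀ m, xOrderLE k x m ≤ (U m).restrictScalars k := by
    refine h.xOrderLE_le (U := fun m => (U m).restrictScalars k) ?_ ?_ ?_
    · intro m n hmn
      exact Submodule.span_mono (by rintro e ⟨β, hβ, rfl⟩; exact ⟨β, hβ.trans hmn, rfl⟩)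
    · intro d hd
      obtain ⟨c, rfl⟩ := hcent d hd
      have : κ c = c • φ (MvPolynomial.monomial 0 1) := by
        rw [smul_def', MvPolynomial.monomial_zero', map_one, map_one, mul_one]
      rw [this]
      exact (U 0).smul_mem c (Submodule.subset_span ⟨0, by simp, rfl⟩)
    · intro m u hu i
      change u * y i ∈ U (m + 1)
      induction hu using Submodule.span_induction with
      | mem e he =>
        obtain ⟨β, hβ, rfl⟩ := he
        refine Submodule.subset_span ⟨β + Finsupp.single i 1, ?_, ?_⟩
        · rw [map_add, Finsupp.degree_single]; omega
        · rw [← hφ i, ← map_mul, MvPolynomial.X, MvPolynomial.monomial_mul, one_mul]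
      | zero => rw [zero_mul]; exact zero_mem _
      | add u v _ _ hu hv => rw [add_mul]; exact add_mem hu hv
      | smul c u _ hu => rw [smul_mul_assoc]; exact Submodule.smul_mem _ c hu
  have hUT : ∀ m, V m ≤ Submodule.span K (Set.range (T m)) := by
    intro m
    refine le_trans (show V m ≤ U m from hVU m) (Submodule.span_mono ?_)
    rintro e ⟨β, hβ, rfl⟩
    refine ⟨fun i => ⟨β i, Nat.lt_succ_of_le ((Finsupp.le_degree i β).trans hβ)⟩, ?_⟩
    change φ _ = φ _
    congr 2
    ext i
    simp
  have hfin : ∀ m, FiniteDimensional K (V m) := fun m =>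
    have : FiniteDimensional K (Submodule.span K (Set.range (T m))) :=
      FiniteDimensional.span_of_finite K (Set.finite_range _)
    Submodule.finiteDimensional_of_le (hUT m)
  refine exists_common_left_multiple_of_growth V (fun m n hmn => ?_) ?_ (Fintype.card ι) ?_ ?_ a s
  · exact fun d hd => xOrderLE_mono hmn hd
  · intro hbot
    have h1 : (1 : E) ∈ V 0 := one_mem_xOrderLE
    rw [hbot, Submodule.mem_bot] at h1
    exact one_ne_zero h1
  · intro m
    have : FiniteDimensional K (Submodule.span K (Set.range (T m))) :=
      FiniteDimensional.span_of_finite K (Set.finite_range _)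
    refine (Submodule.finrank_mono (hUT m)).trans ((finrank_range_le_card (T m)).trans ?_)
    simp
  · intro e
    obtain ⟨q, hq⟩ := hexh e
    exact ⟨q, fun m v hv => mul_mem_xOrderLE hv hq⟩

/-- A ring which is exhausted by the order filtration of a canonical pair, and in which the
centralizer of the `x_i` is a field, is an Ore domain. The right Ore condition is the left one for
the opposite ring, where `(x, -y)` is a canonical pair. -/
theorem IsCanonicalPair.isOreDomain [Nontrivial E] (h : IsCanonicalPair x y) (κ : K →ₐ[k] E)
    (hκ : ∀ c i, κ c * x i = x i * κ c) (hcent : ∀ d ∈ xOrderLE k x 0, ∃ c, κ c = d)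
    (hexh : ∀ d : E, ∃ m, d ∈ xOrderLE k x m) : IsOreDomain E := by
  have : NoZeroDivisors E := by
    refine noZeroDivisors_of_xOrderLE h.x_comm hexh fun d hd e he hde => ?_
    obtain ⟨c, rfl⟩ := hcent d hd
    obtain ⟨c', rfl⟩ := hcent e he
    rw [← map_mul, map_eq_zero, mul_eq_zero] at hde
    simpa using hde
  have : IsDomain E := NoZeroDivisors.to_isDomain E
  refine { left_ore := fun a s hs => ?_, right_ore := fun a s hs => ?_ }
  · obtain ⟨u, v, huv, he⟩ := h.exists_common_left_multiple κ hκ hcent hexh a s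
    refine ⟨v, u, fun hu => ?_, he⟩
    rw [hu, zero_mul, eq_comm, mul_eq_zero] at he
    tauto
  · let κ' : K →ₐ[k] Eᵐᵒᵖ :=
      { toFun := fun c => MulOpposite.op (κ c)
        map_one' := by rw [map_one]; rfl
        map_zero' := by rw [map_zero]; rfl
        map_add' := fun c c' => by rw [map_add]; rfl
        map_mul' := fun c c' => by rw [mul_comm, map_mul]; rfl
        commutes' := fun c => by rw [AlgHom.commutes]; rfl }
    obtain ⟨u, v, huv, he⟩ := h.op.exists_common_left_multiple κ'
      (fun c i => congrArg MulOpposite.op (hκ c i).symm)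
      (fun d hd => by
        have hd' : d.unop ∈ xOrderLE k x 0 := by
          refine mem_xOrderLE_zero.2 fun i => ?_
          have := congrArg MulOpposite.unop (mem_xOrderLE_zero.1 hd i)
          rw [bracketRight_apply, sub_eq_zero]
          exact (sub_eq_zero.1 this).symm
        obtain ⟨c, hc⟩ := hcent _ hd'
        exact ⟨c, congrArg MulOpposite.op hc⟩)
      (fun d => by
        obtain ⟨m, hm⟩ := hexh d.unop
        exact ⟨m, mem_xOrderLE_op hm⟩) (MulOpposite.op a) (MulOpposite.op s)
    have he' : a * u.unop = s * v.unop := congrArg MulOpposite.unop he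
    refine ⟨v.unop, u.unop, fun hu => ?_, he'⟩
    rw [hu, mul_zero, eq_comm, mul_eq_zero] at he'
    have hv : v.unop = 0 := by tauto
    rcases huv with h' | h'
    · exact h' (MulOpposite.unop_injective hu)
    · exact h' (MulOpposite.unop_injective hv)

end Ore

/-! ### Differential operators and coordinates -/

section Operators

variable {k A : Type*} [Field k] [CommRing A] [Algebra k A]

variable (k) in
/-- Multiplication by an element of `A`, as a differential operator. -/
def mulOp : A →ₐ[k] diffOps k A :=
  (Algebra.lmul k A).codRestrict (diffOps k A) fun a => ⟨0, a, rfl⟩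

theorem mulOp_apply (a b : A) : (mulOp k a : Module.End k A) b = a * b := rfl

theorem mulOp_mul_apply (a : A) (d : diffOps k A) (b : A) :
    ((mulOp k a * d : diffOps k A) : Module.End k A) b = a * (d : Module.End k A) b := rfl

theorem mulOp_injective : Function.Injective (mulOp k (A := A)) := fun a b h => by
  have := LinearMap.congr_fun (congrArg Subtype.val h) 1
  simpa [mulOp_apply] using this

theorem diffOps_ext {d e : diffOps k A}
    (h : ∀ a, (d : Module.End k A) a = (e : Module.End k A) a) : d = e :=
  Subtype.ext (LinearMap.ext h)

theorem derivation_mem_diffOpsLE (D : Derivation k A A) :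
    (D : Module.End k A) ∈ diffOpsLE k A 1 := by
  refine mem_diffOpsLE_succ.2 fun b => mem_diffOpsLE_zero.2 ⟨D b, LinearMap.ext fun a => ?_⟩
  simp [mul_comm]

/-- A derivation, as a differential operator. -/
def derOp (D : Derivation k A A) : diffOps k A := ⟨D, 1, derivation_mem_diffOpsLE D⟩

theorem derOp_apply (D : Derivation k A A) (a : A) : (derOp D : Module.End k A) a = D a := rfl

theorem bracketRight_mulOp_apply (a : A) (d : diffOps k A) (b : A) :
    (bracketRight k (mulOp k a) d : Module.End k A) b =
      (d : Module.End k A) (a * b) - a * (d : Module.End k A) b := rfl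

theorem bracketRight_mulOp_mem (a : A) {d : diffOps k A} {m : ℕ}
    (hd : (d : Module.End k A) ∈ diffOpsLE k A (m + 1)) :
    (bracketRight k (mulOp k a) d : Module.End k A) ∈ diffOpsLE k A m := hd a

theorem bracketRight_mulOp_eq_zero (a : A) {d : diffOps k A}
    (hd : (d : Module.End k A) ∈ diffOpsLE k A 0) : bracketRight k (mulOp k a) d = 0 := by
  obtain ⟨c, hc⟩ := mem_diffOpsLE_zero.1 hd
  refine diffOps_ext fun b => ?_
  rw [bracketRight_mulOp_apply, ← hc]
  change c * (a * b) - a * (c * b) = 0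
  ring

theorem mem_xOrderLE_of_mem_diffOpsLE {ι : Type*} (x : ι → A) {m : ℕ} {d : diffOps k A}
    (hd : (d : Module.End k A) ∈ diffOpsLE k A m) :
    d ∈ xOrderLE k (fun i => mulOp k (x i)) m := by
  induction m generalizing d with
  | zero => exact mem_xOrderLE_zero.2 fun i => bracketRight_mulOp_eq_zero _ hd
  | succ m ih => exact mem_xOrderLE_succ.2 fun i => ih (bracketRight_mulOp_mem (x i) hd)

theorem exists_mem_xOrderLE {ι : Type*} (x : ι → A) (d : diffOps k A) :
    ∃ m, d ∈ xOrderLE k (fun i => mulOp k (x i)) m :=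
  let ⟨m, hm⟩ := d.2
  ⟨m, mem_xOrderLE_of_mem_diffOpsLE x hm⟩

/-- A differential operator which commutes with elements `x_i` is a multiplication operator if every
derivation killing the `x_i` is zero. By induction on the order, the operator has order at most
`1`. -/
theorem exists_mulOp_eq {ι : Type*} {x : ι → A}
    (hx : ∀ D : Derivation k A A, (∀ i, D (x i) = 0) → D = 0) {d : diffOps k A}
    (hd : d ∈ xOrderLE k (fun i => mulOp k (x i)) 0) : ∃ a, mulOp k a = d := by
  obtain ⟨m, hm⟩ := d.2
  induction m generalizing d with
  | zero =>
    obtain ⟨a, ha⟩ := mem_diffOpsLE_zero.1 hm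
    exact ⟨a, Subtype.ext ha⟩
  | succ m ih =>
    rw [mem_xOrderLE_zero] at hd
    have hb : ∀ b, ∃ a, mulOp k a = bracketRight k (mulOp k b) d := fun b => by
      refine ih (mem_xOrderLE_zero.2 fun i => ?_) (bracketRight_mulOp_mem b hm)
      rw [bracketRight_comm (by rw [← map_mul, mul_comm, map_mul]), hd, map_zero]
    have hmul : ∀ b c, (d : Module.End k A) (b * c) = b * (d : Module.End k A) c +
        ((d : Module.End k A) b - b * (d : Module.End k A) 1) * c := by
      intro b c
      obtain ⟨a, ha⟩ := hb b
      have h1 := LinearMap.congr_fun (congrArg Subtype.val ha) 1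
      have hc := LinearMap.congr_fun (congrArg Subtype.val ha) c
      rw [bracketRight_mulOp_apply, mulOp_apply, mul_one, mul_one] at h1
      rw [bracketRight_mulOp_apply, mulOp_apply] at hc
      rw [← h1, hc]
      ring
    let D : Derivation k A A := Derivation.mk'
      ((d : Module.End k A) - Algebra.lmul k A ((d : Module.End k A) 1)) (fun b c => by
        change (d : Module.End k A) (b * c) - (d : Module.End k A) 1 * (b * c) =
          b * ((d : Module.End k A) c - (d : Module.End k A) 1 * c) +
          c * ((d : Module.End k A) b - (d : Module.End k A) 1 * b)
        rw [hmul]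
        ring)
    have hD : ∀ b, D b = (d : Module.End k A) b - (d : Module.End k A) 1 * b := fun _ => rfl
    have h0 : D = 0 := hx D fun i => by
      have := LinearMap.congr_fun (congrArg Subtype.val (hd i)) 1
      rw [bracketRight_mulOp_apply, mul_one] at this
      rw [hD, mul_comm]
      exact this
    refine ⟨(d : Module.End k A) 1, diffOps_ext fun b => ?_⟩
    have := hD b
    rw [h0, Derivation.zero_apply, eq_comm, sub_eq_zero] at this
    rw [mulOp_apply, this]

end Operators

/-- Coordinates `x_i` of a `k`-algebra `A` together with their partial derivatives `y_i`:
derivations with `y_i x_j = δ_ij`, where every derivation killing all `x_i` is zero. -/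
structure IsDualCoordinates {k ι A : Type*} [Field k] [CommRing A] [Algebra k A] [DecidableEq ι]
    (x : ι → A) (y : ι → Derivation k A A) : Prop where
  apply_eq : ∀ i j, y i (x j) = if i = j then 1 else 0
  eq_zero : ∀ D : Derivation k A A, (∀ i, D (x i) = 0) → D = 0

namespace IsDualCoordinates

variable {k ι A : Type*} [Field k] [CommRing A] [Algebra k A] [DecidableEq ι]
  {x : ι → A} {y : ι → Derivation k A A}

theorem ext (h : IsDualCoordinates x y) {D D' : Derivation k A A}
    (hD : ∀ i, D (x i) = D' (x i)) : D = D' :=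
  sub_eq_zero.1 (h.eq_zero _ fun i => by rw [Derivation.sub_apply, hD, sub_self])

theorem lie_eq_zero (h : IsDualCoordinates x y) (i j : ι) : ⁅y i, y j⁆ = 0 :=
  h.eq_zero _ fun l => by
    rw [Derivation.commutator_apply, h.apply_eq, h.apply_eq]
    split_ifs <;> simp

theorem isCanonicalPair (h : IsDualCoordinates x y) :
    IsCanonicalPair (fun i => mulOp k (x i)) (fun i => derOp (y i)) where
  x_comm i j := by rw [← map_mul, mul_comm, map_mul]
  y_comm i j := diffOps_ext fun a => by
    have := Derivation.congr_fun (h.lie_eq_zero i j) a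
    rw [Derivation.commutator_apply, Derivation.zero_apply, sub_eq_zero] at this
    exact this
  y_x i j := diffOps_ext fun a => by
    change y i (x j * a) - x j * y i a = _
    rw [Derivation.leibniz, h.apply_eq]
    split_ifs <;> simp

/-- The algebra of differential operators on a field with dual coordinates is an Ore domain. -/
theorem isOreDomain_diffOps [CharZero k] [Finite ι] {K : Type*} [Field K] [Algebra k K]
    {x : ι → K} {y : ι → Derivation k K K} (h : IsDualCoordinates x y) :
    IsOreDomain (diffOps k K) := by
  have := Fintype.ofFinite ι
  have : Nontrivial (diffOps k K) := (mulOp_injective (k := k) (A := K)).nontrivial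
  exact h.isCanonicalPair.isOreDomain (mulOp k)
    (fun c i => by rw [← map_mul, mul_comm, map_mul]) (fun d hd => exists_mulOp_eq h.eq_zero hd)
    (exists_mem_xOrderLE x)

end IsDualCoordinates

/-! ### Extension of differential operators to the fraction field -/

section Restriction

variable {k A : Type*} [Field k] [CommRing A] [Algebra k A]

theorem algebraMap_smul_of_tower (K : Type*) [Field K] [Algebra k K] [Algebra A K]
    [IsScalarTower k A K] (c : k) (a : A) : algebraMap A K (c • a) = c • algebraMap A K a :=
  map_smul (IsScalarTower.toAlgHom k A K) c a

/-- An operator on the fraction field which maps `A` into `A` restricts to a differential operator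
of the same order. -/
theorem mem_diffOpsLE_of_apply_algebraMap {K : Type*} [Field K] [Algebra k K] [Algebra A K]
    [IsFractionRing A K] {m : ℕ} {e : Module.End k K} {d : Module.End k A}
    (he : e ∈ diffOpsLE k K m) (h : ∀ a : A, e (algebraMap A K a) = algebraMap A K (d a)) :
    d ∈ diffOpsLE k A m := by
  have hinj := IsFractionRing.injective A K
  induction m generalizing e d with
  | zero =>
    obtain ⟨c, rfl⟩ := mem_diffOpsLE_zero.1 he
    refine mem_diffOpsLE_zero.2 ⟨d 1, LinearMap.ext fun a => hinj ?_⟩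
    have h1 := h 1
    have ha := h a
    simp only [map_one, Algebra.coe_lmul_eq_mul, LinearMap.mul_apply', mul_one] at h1 ha ⊢
    rw [map_mul, ← h1, ha]
  | succ m ih =>
    refine mem_diffOpsLE_succ.2 fun b => ih (he (algebraMap A K b)) fun a => ?_
    change e (algebraMap A K b * algebraMap A K a) - algebraMap A K b * e (algebraMap A K a) =
      algebraMap A K (d (b * a) - b * d a)
    rw [← map_mul, h, h, map_sub, map_mul (algebraMap A K) b]

end Restriction

section FractionField

variable {k A K : Type*} [Field k] [CommRing A] [IsDomain A] [Field K] [Algebra k K]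
  [Algebra A K] [IsFractionRing A K]

/-- A differential operator on a fraction field of `A` is determined by its restriction to `A`. -/
theorem eq_zero_of_apply_algebraMap {m : ℕ} {e : Module.End k K} (he : e ∈ diffOpsLE k K m)
    (h : ∀ a : A, e (algebraMap A K a) = 0) : e = 0 := by
  induction m generalizing e with
  | zero =>
    obtain ⟨c, rfl⟩ := mem_diffOpsLE_zero.1 he
    have := h 1
    simp only [map_one, Algebra.coe_lmul_eq_mul, LinearMap.mul_apply', mul_one] at this
    simp [this]
  | succ m ih =>
    ext z
    obtain ⟨a, s, hs, rfl⟩ := IsFractionRing.div_surjective A z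
    have hs0 : algebraMap A K s ≠ 0 := IsFractionRing.to_map_ne_zero_of_mem_nonZeroDivisors hs
    have h0 := ih (he (algebraMap A K s)) fun b => by
      change e (algebraMap A K s * algebraMap A K b) -
        algebraMap A K s * e (algebraMap A K b) = 0
      rw [← map_mul, h, h, mul_zero, sub_zero]
    have h1 : e (algebraMap A K s * (algebraMap A K a / algebraMap A K s)) -
        algebraMap A K s * e (algebraMap A K a / algebraMap A K s) = 0 :=
      LinearMap.congr_fun h0 (algebraMap A K a / algebraMap A K s)
    rw [mul_div_cancel₀ _ hs0, h, zero_sub, neg_eq_zero, mul_eq_zero] at h1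
    exact h1.resolve_left hs0

theorem eq_of_apply_algebraMap {m : ℕ} {e e' : Module.End k K} (he : e ∈ diffOpsLE k K m)
    (he' : e' ∈ diffOpsLE k K m)
    (h : ∀ a : A, e (algebraMap A K a) = e' (algebraMap A K a)) : e = e' :=
  sub_eq_zero.1 (eq_zero_of_apply_algebraMap (A := A) (sub_mem he he') fun a => by
    rw [LinearMap.sub_apply, h, sub_self])

theorem diffOps_ext_of_algebraMap {e e' : diffOps k K}
    (h : ∀ a : A, (e : Module.End k K) (algebraMap A K a) =
      (e' : Module.End k K) (algebraMap A K a)) : e = e' := by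
  obtain ⟨m, hm⟩ := e.2
  obtain ⟨m', hm'⟩ := e'.2
  exact Subtype.ext (eq_of_apply_algebraMap (diffOpsLE_mono (le_max_left m m') hm)
    (diffOpsLE_mono (le_max_right m m') hm') h)

variable [Algebra k A] [IsScalarTower k A K]

/-- Differential operators extend to the fraction field, without raising the order. With `ε_s` the
extension of `[d, s]`, which exists by induction, the extension of `d` is forced to send `a / s` to
`(d a - ε_s (a / s)) / s`. -/
theorem exists_diffOpsLE_extension {m : ℕ} {d : Module.End k A} (hd : d ∈ diffOpsLE k A m) :
    ∃ e ∈ diffOpsLE k K m, ∀ a : A, e (algebraMap A K a) = algebraMap A K (d a) := by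
  have hinj := IsFractionRing.injective A K
  induction m generalizing d with
  | zero =>
    obtain ⟨c, rfl⟩ := mem_diffOpsLE_zero.1 hd
    exact ⟨_, mem_diffOpsLE_zero.2 ⟨algebraMap A K c, rfl⟩, fun a => (map_mul _ c a).symm⟩
  | succ m ih =>
    choose ε hε hεa using fun s => ih (hd s)
    replace hεa : ∀ s a, ε s (algebraMap A K a) = algebraMap A K (d (s * a) - s * d a) := hεa
    have hmul : ∀ s t z, ε (s * t) z =
        ε s (algebraMap A K t * z) + algebraMap A K s * ε t z := by
      intro s t z
      have h1 : ε s * Algebra.lmul k K (algebraMap A K t) ∈ diffOpsLE k K m :=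
        diffOpsLE_mul m 0 (hε s) (mem_diffOpsLE_zero.2 ⟨_, rfl⟩)
      have h2 : Algebra.lmul k K (algebraMap A K s) * ε t ∈ diffOpsLE k K m := by
        simpa using diffOpsLE_mul 0 m (mem_diffOpsLE_zero.2 ⟨algebraMap A K s, rfl⟩) (hε t)
      refine LinearMap.congr_fun (eq_of_apply_algebraMap (A := A) (hε (s * t))
        (add_mem h1 h2) fun a => ?_) z
      change _ = ε s (algebraMap A K t * algebraMap A K a) +
        algebraMap A K s * ε t (algebraMap A K a)
      rw [← map_mul, hεa, hεa, hεa, ← map_mul, ← map_add]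
      congr 1
      rw [mul_assoc]
      ring
    -- The prescribed value of the extension at `a / s`.
    let F : A → A → K := fun a s => (algebraMap A K (d a) -
      ε s (algebraMap A K a / algebraMap A K s)) / algebraMap A K s
    have hF : ∀ a s t, algebraMap A K s ≠ 0 → algebraMap A K t ≠ 0 → F (t * a) (t * s) = F a s := by
      intro a s t hs ht
      simp only [F]
      have h1 : algebraMap A K (t * a) / algebraMap A K (t * s) =
          algebraMap A K a / algebraMap A K s := by
        rw [map_mul, map_mul, mul_div_mul_left _ _ ht]
      rw [h1, hmul, mul_div_cancel₀ _ hs, hεa, map_mul (algebraMap A K) t s,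
        div_eq_div_iff (mul_ne_zero ht hs) hs, map_sub, map_mul (algebraMap A K) t]
      ring
    have hF' : ∀ a s b t, algebraMap A K s ≠ 0 → algebraMap A K t ≠ 0 →
        algebraMap A K a / algebraMap A K s = algebraMap A K b / algebraMap A K t →
        F a s = F b t := by
      intro a s b t hs ht h
      rw [div_eq_div_iff hs ht, ← map_mul, ← map_mul] at h
      rw [← hF a s t hs ht, ← hF b t s ht hs, mul_comm t a, hinj h, mul_comm b s, mul_comm t s]
    choose num den hden hfrac using IsFractionRing.div_surjective A (K := K)
    have hden0 : ∀ z, algebraMap A K (den z) ≠ 0 := fun z =>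
      IsFractionRing.to_map_ne_zero_of_mem_nonZeroDivisors (hden z)
    have hEF : ∀ a s, algebraMap A K s ≠ 0 →
        F (num (algebraMap A K a / algebraMap A K s)) (den (algebraMap A K a / algebraMap A K s)) =
          F a s := fun a s hs => hF' _ _ _ _ (hden0 _) hs (hfrac _)
    have hlin : ∀ a b s, F (a + b) s = F a s + F b s := fun a b s => by
      simp only [F, map_add, add_div]
      ring
    let e : Module.End k K :=
      { toFun := fun z => F (num z) (den z)
        map_add' := fun z w => by
          have hs := mul_ne_zero (hden0 z) (hden0 w)
          rw [← map_mul] at hs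
          have hz : z = algebraMap A K (den w * num z) / algebraMap A K (den z * den w) := by
            conv_lhs => rw [← hfrac z]
            rw [mul_comm (den z), map_mul, map_mul, mul_div_mul_left _ _ (hden0 w)]
          have hw : w = algebraMap A K (den z * num w) / algebraMap A K (den z * den w) := by
            conv_lhs => rw [← hfrac w]
            rw [map_mul, map_mul, mul_div_mul_left _ _ (hden0 z)]
          generalize den z * den w = s at hs hz hw
          generalize den w * num z = a at hz
          generalize den z * num w = b at hw
          subst hz hw
          rw [← add_div, ← map_add, hEF _ _ hs, hEF _ _ hs, hEF _ _ hs, hlin]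
        map_smul' := fun c z => by
          have hz := hfrac z
          have hs := hden0 z
          generalize den z = s at hz hs
          generalize num z = a at hz
          subst hz
          have hc : c • (algebraMap A K a / algebraMap A K s) =
              algebraMap A K (c • a) / algebraMap A K s := by
            rw [algebraMap_smul_of_tower K, smul_div_assoc]
          rw [hc, hEF _ _ hs]
          simp only [F, map_smul, algebraMap_smul_of_tower K, RingHom.id_apply, smul_div_assoc,
            ← smul_sub] }
    have he : ∀ a s, algebraMap A K s ≠ 0 → e (algebraMap A K a / algebraMap A K s) = F a s := hEF
    have hcomm : ∀ b z, e (algebraMap A K b * z) - algebraMap A K b * e z = ε b z := by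
      intro b z
      obtain ⟨a, s, hs, rfl⟩ := IsFractionRing.div_surjective A z
      have hs0 : algebraMap A K s ≠ 0 := IsFractionRing.to_map_ne_zero_of_mem_nonZeroDivisors hs
      rw [← mul_div_assoc, ← map_mul, he _ _ hs0, he _ _ hs0]
      have h1 := hmul b s (algebraMap A K a / algebraMap A K s)
      have h2 := hmul s b (algebraMap A K a / algebraMap A K s)
      rw [mul_comm s b, h1, mul_div_cancel₀ _ hs0, hεa, ← mul_div_assoc, ← map_mul, map_sub,
        map_mul (algebraMap A K) b (d a)] at h2
      simp only [F]
      field_simp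
      linear_combination h2
    refine ⟨e, mem_diffOpsLE_succ.2 fun z => ?_, fun a => ?_⟩
    · have hb : ∀ b : A, e * Algebra.lmul k K (algebraMap A K b) -
          Algebra.lmul k K (algebraMap A K b) * e = ε b := fun b => LinearMap.ext (hcomm b)
      obtain ⟨b, t, ht, rfl⟩ := IsFractionRing.div_surjective A z
      have ht0 : algebraMap A K t ≠ 0 := IsFractionRing.to_map_ne_zero_of_mem_nonZeroDivisors ht
      have h0 : ∀ c : K, Algebra.lmul k K c ∈ diffOpsLE k K 0 := fun c =>
        mem_diffOpsLE_zero.2 ⟨c, rfl⟩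
      have hmem : (ε b - Algebra.lmul k K (algebraMap A K b / algebraMap A K t) * ε t) *
          Algebra.lmul k K (algebraMap A K t)⁻¹ ∈ diffOpsLE k K m := by
        refine diffOpsLE_mul m 0 (sub_mem (hε b) ?_) (h0 _)
        simpa using diffOpsLE_mul 0 m (h0 _) (hε t)
      convert hmem using 1
      rw [← hb b, ← hb t]
      ext w
      change e (algebraMap A K b / algebraMap A K t * w) -
          algebraMap A K b / algebraMap A K t * e w =
        (e (algebraMap A K b * ((algebraMap A K t)⁻¹ * w)) -
          algebraMap A K b * e ((algebraMap A K t)⁻¹ * w)) -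
        algebraMap A K b / algebraMap A K t * (e (algebraMap A K t * ((algebraMap A K t)⁻¹ * w)) -
          algebraMap A K t * e ((algebraMap A K t)⁻¹ * w))
      rw [mul_inv_cancel_left₀ ht0, ← mul_assoc (algebraMap A K b), ← div_eq_mul_inv]
      field_simp
      ring
    · have h1 := he a 1 (by simp)
      rw [map_one, div_one] at h1
      rw [h1]
      simp [F, hεa]

variable (k A K) in
/-- The embedding `D(A) → D(Frac A)` which extends differential operators to the fraction field. -/
def diffOpsExtend : diffOps k A →ₐ[k] diffOps k K :=
  have hex : ∀ d : diffOps k A, ∃ e : diffOps k K, ∀ a : A,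
      (e : Module.End k K) (algebraMap A K a) = algebraMap A K ((d : Module.End k A) a) :=
    fun d => by
      obtain ⟨m, hm⟩ := d.2
      obtain ⟨e, he, h⟩ := exists_diffOpsLE_extension (K := K) hm
      exact ⟨⟨e, m, he⟩, h⟩
  AlgHom.ofLinearMap
    { toFun := fun d => (hex d).choose
      map_add' := fun d d' => diffOps_ext_of_algebraMap (A := A) fun a => by
        rw [(hex (d + d')).choose_spec]
        change _ = ((hex d).choose : Module.End k K) _ + ((hex d').choose : Module.End k K) _
        rw [(hex d).choose_spec, (hex d').choose_spec, ← map_add]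
        rfl
      map_smul' := fun c d => diffOps_ext_of_algebraMap (A := A) fun a => by
        rw [(hex (c • d)).choose_spec]
        change _ = c • ((hex d).choose : Module.End k K) _
        rw [(hex d).choose_spec, ← algebraMap_smul_of_tower K]
        rfl }
    (diffOps_ext_of_algebraMap (A := A) fun a => (hex 1).choose_spec a)
    (fun d d' => diffOps_ext_of_algebraMap (A := A) fun a => by
      refine ((hex (d * d')).choose_spec a).trans ?_
      change _ = ((hex d).choose : Module.End k K) (((hex d').choose : Module.End k K) _)
      rw [(hex d').choose_spec, (hex d).choose_spec]
      rfl)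

theorem diffOpsExtend_apply (d : diffOps k A) (a : A) :
    (diffOpsExtend k A K d : Module.End k K) (algebraMap A K a) =
      algebraMap A K ((d : Module.End k A) a) := by
  obtain ⟨m, hm⟩ := d.2
  obtain ⟨e, he, h⟩ := exists_diffOpsLE_extension (K := K) hm
  exact Exists.choose_spec (p := fun e : diffOps k K => ∀ a : A,
    (e : Module.End k K) (algebraMap A K a) = algebraMap A K ((d : Module.End k A) a))
    ⟨⟨e, m, he⟩, h⟩ a

theorem diffOpsExtend_eq {d : diffOps k A} {e : diffOps k K}
    (h : ∀ a : A, (e : Module.End k K) (algebraMap A K a) =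
      algebraMap A K ((d : Module.End k A) a)) : diffOpsExtend k A K d = e :=
  diffOps_ext_of_algebraMap (A := A) fun a => by rw [diffOpsExtend_apply, h]

theorem diffOpsExtend_mulOp (a : A) :
    diffOpsExtend k A K (mulOp k a) = mulOp k (algebraMap A K a) :=
  diffOpsExtend_eq fun b => (map_mul (algebraMap A K) a b).symm

theorem diffOpsExtend_injective : Function.Injective (diffOpsExtend k A K) := fun d d' h =>
  diffOps_ext fun a => IsFractionRing.injective A K <| by
    rw [← diffOpsExtend_apply, ← diffOpsExtend_apply, h]

variable [Algebra.FiniteType k A]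

/-- An operator on the fraction field of a finitely generated algebra `A` maps `A` into `A` after
multiplication by a nonzero element of `A`: this may be checked on generators. -/
theorem exists_mul_apply_mem_range {m : ℕ} {e : Module.End k K} (he : e ∈ diffOpsLE k K m) :
    ∃ f : A, algebraMap A K f ≠ 0 ∧
      ∀ a : A, ∃ b : A, algebraMap A K f * e (algebraMap A K a) = algebraMap A K b := by
  classical
  have hfrac : ∀ z : K, ∃ f b : A, algebraMap A K f ≠ 0 ∧
      algebraMap A K f * z = algebraMap A K b := fun z => by
    obtain ⟨a, s, hs, rfl⟩ := IsFractionRing.div_surjective A z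
    have hs0 : algebraMap A K s ≠ 0 := IsFractionRing.to_map_ne_zero_of_mem_nonZeroDivisors hs
    exact ⟨s, a, hs0, mul_div_cancel₀ _ hs0⟩
  induction m generalizing e with
  | zero =>
    obtain ⟨c, rfl⟩ := mem_diffOpsLE_zero.1 he
    obtain ⟨f, b, hf, hb⟩ := hfrac c
    refine ⟨f, hf, fun a => ⟨b * a, ?_⟩⟩
    rw [map_mul, ← hb]
    exact (mul_assoc _ _ _).symm
  | succ m ih =>
    obtain ⟨S, hS⟩ := Algebra.FiniteType.out (R := k) (A := A)
    choose g hg hga using fun s : A => ih (he (algebraMap A K s))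
    obtain ⟨f₁, b₁, hf₁, hb₁⟩ := hfrac (e 1)
    have hf : algebraMap A K (f₁ * ∏ s ∈ S, g s) ≠ 0 := by
      rw [map_mul, map_prod]
      exact mul_ne_zero hf₁ (Finset.prod_ne_zero_iff.2 fun s _ => hg s)
    refine ⟨f₁ * ∏ s ∈ S, g s, hf, fun a => ?_⟩
    set f := f₁ * ∏ s ∈ S, g s with hfdef
    let P : A → Prop := fun a => ∃ b : A, algebraMap A K f * e (algebraMap A K a) = algebraMap A K b
    have hmem : ∀ b ∈ Algebra.adjoin k (S : Set A), ∀ a, P a → P (b * a) := by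
      intro b hb
      induction hb using Algebra.adjoin_induction with
      | mem s hs =>
        rintro a ⟨c, hc⟩
        obtain ⟨c', hc'⟩ := hga s a
        replace hc' : algebraMap A K (g s) * (e (algebraMap A K s * algebraMap A K a) -
          algebraMap A K s * e (algebraMap A K a)) = algebraMap A K c' := hc'
        refine ⟨s * c + f₁ * (∏ t ∈ S.erase s, g t) * c', ?_⟩
        have hfs : f = f₁ * (∏ t ∈ S.erase s, g t) * g s := by
          rw [hfdef, mul_assoc, Finset.prod_erase_mul S g hs]
        have hfs' := congrArg (algebraMap A K) hfs
        simp only [map_mul, map_add] at hfs' hc ⊢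
        rw [← hc, ← hc']
        linear_combination (e (algebraMap A K s * algebraMap A K a) -
          algebraMap A K s * e (algebraMap A K a)) * hfs'
      | algebraMap c =>
        rintro a ⟨b, hb⟩
        refine ⟨c • b, ?_⟩
        rw [← Algebra.smul_def c a, algebraMap_smul_of_tower K, map_smul, mul_smul_comm, hb,
          algebraMap_smul_of_tower K]
      | add b c _ _ hb hc =>
        intro a ha
        obtain ⟨u, hu⟩ := hb a ha
        obtain ⟨v, hv⟩ := hc a ha
        exact ⟨u + v, by rw [add_mul, map_add, map_add, mul_add, hu, hv, map_add]⟩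
      | mul b c _ _ hb hc =>
        intro a ha
        rw [mul_assoc]
        exact hb _ (hc _ ha)
    have h1 : P 1 := by
      refine ⟨b₁ * ∏ s ∈ S, g s, ?_⟩
      rw [map_one, hfdef, map_mul, map_mul, ← hb₁]
      ring
    have := hmem a (by rw [hS]; trivial) 1 h1
    rwa [mul_one] at this

/-- Operators on the fraction field are left fractions of operators on `A`, with denominators in
`A`. -/
theorem exists_mulOp_mul_eq_diffOpsExtend (e : diffOps k K) :
    ∃ f : A, algebraMap A K f ≠ 0 ∧
      ∃ d, mulOp k (algebraMap A K f) * e = diffOpsExtend k A K d := by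
  obtain ⟨m, hm⟩ := e.2
  obtain ⟨f, hf, hfa⟩ := exists_mul_apply_mem_range (A := A) hm
  choose d hd using hfa
  have hinj := IsFractionRing.injective A K
  let d' : Module.End k A :=
    { toFun := d
      map_add' := fun a b => hinj (by
        rw [← hd, map_add, map_add, mul_add, hd, hd, map_add])
      map_smul' := fun c a => hinj (by
        rw [← hd, algebraMap_smul_of_tower K, map_smul, mul_smul_comm, hd, RingHom.id_apply,
          algebraMap_smul_of_tower K]) }
  have hmem : (mulOp k (algebraMap A K f) * e : diffOps k K).1 ∈ diffOpsLE k K m := by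
    have := diffOpsLE_mul 0 m (mem_diffOpsLE_zero.2 ⟨algebraMap A K f, rfl⟩) hm
    rwa [zero_add] at this
  refine ⟨f, hf, ⟨d', m, mem_diffOpsLE_of_apply_algebraMap hmem hd⟩, ?_⟩
  exact (diffOpsExtend_eq hd).symm

/-- Operators on the fraction field are right fractions of operators on `A`, with denominators in
`A`. -/
theorem exists_mul_mulOp_eq_diffOpsExtend (e : diffOps k K) :
    ∃ f : A, algebraMap A K f ≠ 0 ∧
      ∃ d, e * mulOp k (algebraMap A K f) = diffOpsExtend k A K d := by
  obtain ⟨f, hf, d, hd⟩ := exists_mulOp_mul_eq_diffOpsExtend (A := A) e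
  obtain ⟨m, hm⟩ := exists_mem_xOrderLE (fun _ : Unit => f) d
  obtain ⟨d', hd'⟩ := exists_mul_pow_eq_mul (mulOp k f) (m + 1) d
    (bracketRight_iterate_eq_zero () hm)
  refine ⟨f ^ (m + 1), by rw [map_pow]; exact pow_ne_zero _ hf, d', ?_⟩
  have h := congrArg (diffOpsExtend k A K) hd'
  rw [map_mul, map_mul, map_pow, diffOpsExtend_mulOp, ← hd, mul_assoc] at h
  have h1 : mulOp k (algebraMap A K f)⁻¹ * mulOp k (algebraMap A K f) = 1 := by
    rw [← map_mul, inv_mul_cancel₀ hf, map_one]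
  have h2 := congrArg (mulOp k (algebraMap A K f)⁻¹ * ·) h
  simp only [← mul_assoc, h1, one_mul] at h2
  rw [map_pow, map_pow]
  exact h2

end FractionField

/-- A subring of an Ore domain is an Ore domain if every element of the large ring is brought into
the subring by nonzero factors from the subring, on the left and on the right. -/
theorem isOreDomain_of_injective {R S F : Type*} [Ring R] [Ring S] [IsOreDomain S]
    [FunLike F R S] [RingHomClass F R S] (j : F)
    (hj : Function.Injective j) (hl : ∀ s : S, ∃ f : R, f ≠ 0 ∧ ∃ r, j f * s = j r)
    (hr : ∀ s : S, ∃ f : R, f ≠ 0 ∧ ∃ r, s * j f = j r) : IsOreDomain R := by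
  have : IsDomain R := hj.isDomain (RingHomClass.toRingHom j)
  have hj0 : ∀ {r}, r ≠ 0 → j r ≠ 0 := fun h => (map_ne_zero_iff j hj).2 h
  refine { left_ore := fun a s hs => ?_, right_ore := fun a s hs => ?_ }
  · obtain ⟨b, t, ht, h⟩ := IsOreDomain.left_ore (j a) (j s) (hj0 hs)
    obtain ⟨f, hf, t', ht'⟩ := hl t
    obtain ⟨g, hg, b', hb'⟩ := hl (j f * b)
    have ht0 : t' ≠ 0 := by
      rintro rfl
      rw [map_zero] at ht'
      exact mul_ne_zero (hj0 hf) ht ht'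
    refine ⟨b', g * t', mul_ne_zero hg ht0, hj ?_⟩
    rw [map_mul, map_mul, map_mul, ← ht', ← hb', mul_assoc, mul_assoc, mul_assoc, mul_assoc, h]
  · obtain ⟨b, t, ht, h⟩ := IsOreDomain.right_ore (j a) (j s) (hj0 hs)
    obtain ⟨f, hf, t', ht'⟩ := hr t
    obtain ⟨g, hg, b', hb'⟩ := hr (b * j f)
    have ht0 : t' ≠ 0 := by
      rintro rfl
      rw [map_zero] at ht'
      exact mul_ne_zero ht (hj0 hf) ht'
    refine ⟨b', t' * g, mul_ne_zero ht0 hg, hj ?_⟩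
    rw [map_mul, map_mul, map_mul, ← ht', ← hb', ← mul_assoc, ← mul_assoc, ← mul_assoc,
      ← mul_assoc, h]

/-- The algebra of differential operators on a finitely generated domain is an Ore domain if this
holds for its fraction field. -/
theorem isOreDomain_diffOps_of_fractionField {k A K : Type*} [Field k] [CommRing A]
    [IsDomain A] [Algebra k A] [Field K] [Algebra k K] [Algebra A K] [IsFractionRing A K]
    [IsScalarTower k A K] [Algebra.FiniteType k A] [IsOreDomain (diffOps k K)] :
    IsOreDomain (diffOps k A) := by
  have hne : ∀ {f : A}, algebraMap A K f ≠ 0 → mulOp k f ≠ 0 := fun {f} hf h => by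
    rw [← map_zero (mulOp k), mulOp_injective.eq_iff] at h
    rw [h, map_zero] at hf
    exact hf rfl
  refine isOreDomain_of_injective (diffOpsExtend k A K)
    diffOpsExtend_injective (fun e => ?_) (fun e => ?_)
  · obtain ⟨f, hf, d, hd⟩ := exists_mulOp_mul_eq_diffOpsExtend (A := A) e
    rw [← diffOpsExtend_mulOp] at hd
    exact ⟨mulOp k f, hne hf, d, hd⟩
  · obtain ⟨f, hf, d, hd⟩ := exists_mul_mulOp_eq_diffOpsExtend (A := A) e
    rw [← diffOpsExtend_mulOp] at hd
    exact ⟨mulOp k f, hne hf, d, hd⟩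

/-! ### Injectivity of homomorphisms out of the Weyl algebra -/

section YFiltration

variable {k ι R : Type*} [Field k] [Ring R] [Algebra k R]

/-- The filtration of the sums `∑ c_α y^α` by degree, with `c_α` in a submodule `U`. The index is
shifted: level `m + 1` consists of the sums of degree at most `m`, and level `0` is zero. -/
def yFiltration (U : Submodule k R) (y : ι → R) : ℕ → Submodule k R
  | 0 => ⊥
  | m + 1 => U ⊔ yFiltration U y m ⊔ ⨆ i, (yFiltration U y m).map (LinearMap.mulRight k (y i))

variable {U : Submodule k R} {x y : ι → R}

theorem yFiltration_le_iff {m : ℕ} {V : Submodule k R} :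
    yFiltration U y (m + 1) ≤ V ↔ U ≤ V ∧ yFiltration U y m ≤ V ∧
      ∀ u ∈ yFiltration U y m, ∀ i, u * y i ∈ V := by
  simp only [yFiltration, sup_le_iff, iSup_le_iff, Submodule.map_le_iff_le_comap, and_assoc]
  exact and_congr_right fun _ => and_congr_right fun _ =>
    ⟨fun h u hu i => h i hu, fun h i u hu => h u hu i⟩

theorem yFiltration_mono : Monotone (yFiltration U y) :=
  monotone_nat_of_le_succ fun _ => (yFiltration_le_iff.1 le_rfl).2.1

theorem mul_mem_yFiltration {m : ℕ} {u : R} (hu : u ∈ yFiltration U y m) (i : ι) :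
    u * y i ∈ yFiltration U y (m + 1) := (yFiltration_le_iff.1 le_rfl).2.2 u hu i

theorem subset_yFiltration (m : ℕ) : U ≤ yFiltration U y (m + 1) := (yFiltration_le_iff.1 le_rfl).1

theorem mul_left_mem_yFiltration {a : R} (ha : ∀ u ∈ U, a * u ∈ U) {m : ℕ} {u : R}
    (hu : u ∈ yFiltration U y m) : a * u ∈ yFiltration U y m := by
  suffices h : ∀ m, yFiltration U y m ≤ (yFiltration U y m).comap (LinearMap.mulLeft k a) from
    h m hu
  intro m
  induction m with
  | zero => exact bot_le
  | succ m ih =>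
    refine yFiltration_le_iff.2 ⟨fun u hu => subset_yFiltration m (ha u hu),
      fun u hu => yFiltration_mono (Nat.le_succ m) (ih hu), fun u hu i => ?_⟩
    rw [Submodule.mem_comap, LinearMap.mulLeft_apply, ← mul_assoc]
    exact mul_mem_yFiltration (ih hu) i

variable [DecidableEq ι]

theorem IsCanonicalPair.bracketRight_mem_yFiltration (h : IsCanonicalPair x y)
    (hU : U ≤ xOrderLE k x 0) (j : ι) (m : ℕ) {u : R} (hu : u ∈ yFiltration U y (m + 1)) :
    bracketRight k (x j) u ∈ yFiltration U y m := by
  suffices h : ∀ m, yFiltration U y (m + 1) ≤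
      (yFiltration U y m).comap (bracketRight k (x j)) from h m hu
  clear hu
  intro m
  have h0 : U ≤ (yFiltration U y m).comap (bracketRight k (x j)) := fun u hu => by
    rw [Submodule.mem_comap, mem_xOrderLE_zero.1 (hU hu)]
    exact zero_mem _
  induction m with
  | zero =>
    refine yFiltration_le_iff.2 ⟨h0, bot_le, fun u hu i => ?_⟩
    rw [(Submodule.mem_bot k).1 hu, zero_mul]
    exact zero_mem _
  | succ m ih =>
    have ih' := ih fun u hu => by
      rw [Submodule.mem_comap, mem_xOrderLE_zero.1 (hU hu)]
      exact zero_mem _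
    refine yFiltration_le_iff.2 ⟨h0, fun u hu => yFiltration_mono (Nat.le_succ m) (ih' hu),
      fun u hu i => ?_⟩
    rw [Submodule.mem_comap, bracketRight_mul, h.bracketRight_y]
    refine add_mem (mul_mem_yFiltration (ih' hu) i) ?_
    split_ifs
    · rwa [mul_one]
    · rw [mul_zero]; exact zero_mem _

variable [Fintype ι]

theorem IsCanonicalPair.eulerOp_mul_y (h : IsCanonicalPair x y) (u : R) (i : ι) :
    eulerOp k x y (u * y i) = eulerOp k x y u * y i + u * y i := by
  simp only [eulerOp_apply, bracketRight_mul, h.bracketRight_y, add_mul, Finset.sum_add_distrib,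
    Finset.sum_mul]
  congr 1
  · exact Finset.sum_congr rfl fun j _ => by rw [mul_assoc, mul_assoc, h.y_comm]
  · simp [mul_ite, ite_mul]

/-- The Euler operator acts as `m` on sums of degree `m` in the `y_i`, up to lower degree. -/
theorem IsCanonicalPair.eulerOp_sub_mem_yFiltration (h : IsCanonicalPair x y)
    (hU : U ≤ xOrderLE k x 0) (m : ℕ) {u : R} (hu : u ∈ yFiltration U y (m + 1)) :
    eulerOp k x y u - (m : k) • u ∈ yFiltration U y m := by
  suffices h : ∀ m, yFiltration U y (m + 1) ≤
      (yFiltration U y m).comap (eulerOp k x y - (m : k) • LinearMap.id) from h m hu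
  clear hu
  intro m
  have h0 : ∀ u ∈ U, eulerOp k x y u = 0 := fun u hu => by
    rw [eulerOp_apply]
    exact Finset.sum_eq_zero fun i _ => by rw [mem_xOrderLE_zero.1 (hU hu), zero_mul]
  induction m with
  | zero =>
    refine yFiltration_le_iff.2 ⟨fun u hu => ?_, bot_le, fun u hu i => ?_⟩
    · simp [h0 u hu]
    · rw [(Submodule.mem_bot k).1 hu, zero_mul]
      exact zero_mem _
  | succ m ih =>
    refine yFiltration_le_iff.2 ⟨fun u hu => ?_, fun u hu => ?_, fun u hu i => ?_⟩
    · have := (yFiltration U y (m + 1)).smul_mem ((m : k) + 1) (subset_yFiltration m hu)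
      simpa [h0 u hu] using this
    · have := sub_mem (yFiltration_mono (Nat.le_succ m) (ih hu)) hu
      simp only [LinearMap.sub_apply, LinearMap.smul_apply, LinearMap.id_apply,
        Submodule.mem_comap] at this ⊢
      convert this using 1
      push_cast
      module
    · have := mul_mem_yFiltration (ih hu) i
      simp only [LinearMap.sub_apply, LinearMap.smul_apply, LinearMap.id_apply,
        Submodule.mem_comap] at this ⊢
      rw [h.eulerOp_mul_y]
      convert this using 1
      push_cast
      rw [sub_mul, smul_mul_assoc]
      module

/-- A homomorphism out of a ring whose elements are polynomials in the `y_i` with coefficients in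
`U`, commuting with the `x_i`, is injective if it is so on `U`: the kernel is stable under the
commutators with the `x_i`, hence under the Euler operator, which lowers the degree of its
elements. -/
theorem IsCanonicalPair.injective_of_yFiltration [CharZero k] (h : IsCanonicalPair x y)
    (hU : U ≤ xOrderLE k x 0) (hexh : ∀ w : R, ∃ m, w ∈ yFiltration U y m) {S : Type*} [Ring S]
    [Algebra k S] (f : R →ₐ[k] S) (hf : ∀ u ∈ U, f u = 0 → u = 0) : Function.Injective f := by
  rw [injective_iff_map_eq_zero]
  suffices H : ∀ m, ∀ w ∈ yFiltration U y m, f w = 0 → w = 0 from fun w hw =>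
    let ⟨m, hm⟩ := hexh w
    H m w hm hw
  intro m
  induction m with
  | zero => exact fun w hw _ => (Submodule.mem_bot k).1 hw
  | succ m ih =>
    intro w hw hfw
    have hE : eulerOp k x y w = 0 := by
      rw [eulerOp_apply]
      refine Finset.sum_eq_zero fun i _ => ?_
      rw [ih _ (h.bracketRight_mem_yFiltration hU i m hw), zero_mul]
      rw [bracketRight_apply, map_sub, map_mul, map_mul, hfw, zero_mul, mul_zero, sub_zero]
    have hm := h.eulerOp_sub_mem_yFiltration hU m hw
    rw [hE, zero_sub, neg_mem_iff] at hm
    rcases m with _ | m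
    · have : yFiltration U y 1 ≤ U := yFiltration_le_iff.2 ⟨le_rfl, bot_le, fun u hu i => by
        rw [(Submodule.mem_bot k).1 hu, zero_mul]
        exact zero_mem _⟩
      exact hf w (this hw) hfw
    · have hm0 : ((m + 1 : ℕ) : k) ≠ 0 := Nat.cast_ne_zero.2 (Nat.succ_ne_zero m)
      exact ih w ((Submodule.smul_mem_iff _ hm0).1 hm) hfw

end YFiltration

/-! ### The Weyl algebra -/

section Weyl

variable (k : Type*) [Field k] {n : ℕ}

/-- The generator `x_i` of the Weyl algebra. -/
def weylX (i : Fin n) : WeylAlgebra k n :=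
  RingQuot.mkAlgHom k (WeylRel k n) (FreeAlgebra.ι k (Sum.inl i))

/-- The generator `∂_i` of the Weyl algebra. -/
def weylD (i : Fin n) : WeylAlgebra k n :=
  RingQuot.mkAlgHom k (WeylRel k n) (FreeAlgebra.ι k (Sum.inr i))

theorem isCanonicalPair_weyl : IsCanonicalPair (weylX k (n := n)) (weylD k) where
  x_comm i j := by
    have := RingQuot.mkAlgHom_rel k (WeylRel.x_comm (k := k) i j)
    rwa [map_mul, map_mul] at this
  y_comm i j := by
    have := RingQuot.mkAlgHom_rel k (WeylRel.d_comm (k := k) i j)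
    rwa [map_mul, map_mul] at this
  y_x i j := by
    have := RingQuot.mkAlgHom_rel k (WeylRel.d_x (k := k) i j)
    rw [map_sub, map_mul, map_mul] at this
    refine this.trans ?_
    split_ifs <;> simp

variable {k}

theorem weyl_induction {S : Subalgebra k (WeylAlgebra k n)} (hx : ∀ i, weylX k i ∈ S)
    (hd : ∀ i, weylD k i ∈ S) (w : WeylAlgebra k n) : w ∈ S := by
  obtain ⟨v, rfl⟩ := RingQuot.mkAlgHom_surjective k (WeylRel k n) w
  induction v using FreeAlgebra.induction with
  | grade0 c => rw [AlgHom.commutes]; exact S.algebraMap_mem c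
  | grade1 i => rcases i with i | i; exacts [hx i, hd i]
  | mul a b ha hb => rw [map_mul]; exact S.mul_mem ha hb
  | add a b ha hb => rw [map_add]; exact S.add_mem ha hb

/-- The homomorphism from the Weyl algebra determined by a canonical pair. -/
def IsCanonicalPair.weylLift {R : Type*} [Ring R] [Algebra k R] {x y : Fin n → R}
    (h : IsCanonicalPair x y) : WeylAlgebra k n →ₐ[k] R :=
  RingQuot.liftAlgHom k ⟨FreeAlgebra.lift k (Sum.elim x y), by
    rintro _ _ (⟨i, j⟩ | ⟨i, j⟩ | ⟨i, j⟩)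
    · simp [h.x_comm i j]
    · simp [h.y_comm i j]
    · simp only [map_sub, map_mul, FreeAlgebra.lift_ι_apply, Sum.elim_inl, Sum.elim_inr, h.y_x i j]
      split_ifs <;> simp⟩

theorem IsCanonicalPair.weylLift_x {R : Type*} [Ring R] [Algebra k R] {x y : Fin n → R}
    (h : IsCanonicalPair x y) (i : Fin n) : h.weylLift (weylX k i) = x i := by
  simp [weylLift, weylX]

theorem IsCanonicalPair.weylLift_d {R : Type*} [Ring R] [Algebra k R] {x y : Fin n → R}
    (h : IsCanonicalPair x y) (i : Fin n) : h.weylLift (weylD k i) = y i := by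
  simp [weylLift, weylD]

theorem exists_weyl_mvPolynomial_algHom :
    ∃ ψ : MvPolynomial (Fin n) k →ₐ[k] WeylAlgebra k n, ∀ i, ψ (MvPolynomial.X i) = weylX k i :=
  exists_mvPolynomial_algHom _ (isCanonicalPair_weyl k).x_comm

/-- The embedding of the polynomials in the `x_i` into the Weyl algebra. -/
def weylPoly : MvPolynomial (Fin n) k →ₐ[k] WeylAlgebra k n :=
  exists_weyl_mvPolynomial_algHom.choose

theorem weylPoly_X (i : Fin n) : weylPoly (MvPolynomial.X i) = weylX k i :=
  exists_weyl_mvPolynomial_algHom.choose_spec i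

theorem range_weylPoly_le :
    (weylPoly (k := k) (n := n)).range.toSubmodule ≤ xOrderLE k (weylX k) 0 := by
  rintro _ ⟨p, rfl⟩
  refine mem_xOrderLE_zero.2 fun i => ?_
  change weylPoly p * weylX k i - weylX k i * weylPoly p = 0
  rw [← weylPoly_X, ← map_mul, ← map_mul, mul_comm, sub_self]

/-- The Weyl algebra is spanned by normally ordered monomials: the elements whose right
multiplication preserves the union of the filtration form a subalgebra containing the generators. -/
theorem exists_mem_yFiltration_weyl (w : WeylAlgebra k n) :
    ∃ m, w ∈ yFiltration (weylPoly (k := k) (n := n)).range.toSubmodule (weylD k) m := by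
  set T := yFiltration (weylPoly (k := k) (n := n)).range.toSubmodule (weylD k) with hT
  let S : Subalgebra k (WeylAlgebra k n) :=
    { carrier := {w | ∀ m, ∀ u ∈ T m, ∃ m', u * w ∈ T m'}
      mul_mem' := fun {v w} hv hw m u hu => by
        obtain ⟨m', h'⟩ := hv m u hu
        rw [← mul_assoc]
        exact hw m' _ h'
      add_mem' := fun {v w} hv hw m u hu => by
        obtain ⟨m₁, h₁⟩ := hv m u hu
        obtain ⟨m₂, h₂⟩ := hw m u hu
        refine ⟨max m₁ m₂, ?_⟩
        rw [mul_add]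
        exact add_mem (yFiltration_mono (le_max_left _ _) h₁)
          (yFiltration_mono (le_max_right _ _) h₂)
      algebraMap_mem' := fun c m u hu => ⟨m, by
        rw [← Algebra.commutes, ← Algebra.smul_def]
        exact Submodule.smul_mem _ c hu⟩ }
  have hS : w ∈ S := by
    refine weyl_induction (fun j m u hu => ⟨m, ?_⟩)
      (fun i m u hu => ⟨m + 1, mul_mem_yFiltration hu i⟩) w
    have h1 : weylX k j * u ∈ T m := by
      refine mul_left_mem_yFiltration ?_ hu
      rintro _ ⟨p, rfl⟩
      exact ⟨MvPolynomial.X j * p, by rw [← weylPoly_X]; exact map_mul _ _ _⟩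
    have h2 : bracketRight k (weylX k j) u ∈ T m :=
      (isCanonicalPair_weyl k).bracketRight_mem_yFiltration range_weylPoly_le j m
        (yFiltration_mono (Nat.le_succ m) hu)
    rw [bracketRight_apply] at h2
    simpa using add_mem h2 h1
  obtain ⟨m, hm⟩ := hS 1 1 (subset_yFiltration 0 ⟨1, map_one _⟩)
  exact ⟨m, by rwa [one_mul] at hm⟩

theorem IsCanonicalPair.weylLift_injective [CharZero k] {R : Type*} [Ring R] [Algebra k R]
    {x y : Fin n → R} (h : IsCanonicalPair x y) {φ : MvPolynomial (Fin n) k →ₐ[k] R}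
    (hφ : ∀ i, φ (MvPolynomial.X i) = x i) (hinj : Function.Injective φ) :
    Function.Injective (h.weylLift (k := k)) := by
  refine (isCanonicalPair_weyl k).injective_of_yFiltration range_weylPoly_le
    exists_mem_yFiltration_weyl _ ?_
  rintro _ ⟨p, rfl⟩ hp
  have : (h.weylLift (k := k)).comp weylPoly = φ := MvPolynomial.algHom_ext fun i => by
    rw [AlgHom.comp_apply, weylPoly_X, h.weylLift_x, hφ]
  replace hp : h.weylLift (weylPoly p) = 0 := hp
  rw [← AlgHom.comp_apply, this] at hp
  change weylPoly p = 0
  rw [hinj (hp.trans (map_zero φ).symm), map_zero]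

theorem isDualCoordinates_mvPolynomial :
    IsDualCoordinates (k := k) (MvPolynomial.X : Fin n → MvPolynomial (Fin n) k)
      MvPolynomial.pderiv where
  apply_eq i j := by
    rw [MvPolynomial.pderiv_X]
    simp [Pi.single_apply, eq_comm]
  eq_zero D hD := MvPolynomial.derivation_ext fun i => by rw [hD, Derivation.zero_apply]

/-- The Weyl algebra acts faithfully on polynomials, and every differential operator on polynomials
arises from it. -/
theorem weylLift_mvPolynomial_bijective [CharZero k] : Function.Bijective
    ((isDualCoordinates_mvPolynomial (k := k) (n := n)).isCanonicalPair.weylLift (k := k)) := by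
  set h := (isDualCoordinates_mvPolynomial (k := k) (n := n)).isCanonicalPair
  refine ⟨h.weylLift_injective (φ := mulOp k) (fun i => rfl) mulOp_injective, fun d => ?_⟩
  obtain ⟨m, hm⟩ := exists_mem_xOrderLE (k := k) MvPolynomial.X d
  refine h.xOrderLE_le (U := fun _ => (h.weylLift (k := k)).range.toSubmodule)
    (fun _ _ _ => le_rfl) (fun d hd => ?_) (fun m u hu i => ?_) m hm
  · obtain ⟨p, rfl⟩ := exists_mulOp_eq isDualCoordinates_mvPolynomial.eq_zero hd
    have : (h.weylLift (k := k)).comp weylPoly = mulOp k := MvPolynomial.algHom_ext fun i => by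
      rw [AlgHom.comp_apply, weylPoly_X, h.weylLift_x]
    exact ⟨weylPoly p, congrArg (· p) (congrArg DFunLike.coe this)⟩
  · obtain ⟨w, rfl⟩ := hu
    exact ⟨w * weylD k i, (map_mul _ _ _).trans (congrArg _ (h.weylLift_d i))⟩

/-- The Weyl algebra is the algebra of differential operators on the polynomial ring. -/
def weylEquiv (k : Type*) [Field k] [CharZero k] (n : ℕ) :
    WeylAlgebra k n ≃ₐ[k] diffOps k (MvPolynomial (Fin n) k) :=
  AlgEquiv.ofBijective _ weylLift_mvPolynomial_bijective

theorem isOreDomain_weylAlgebra (k : Type*) [Field k] [CharZero k] (n : ℕ)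
    [IsOreDomain (diffOps k (MvPolynomial (Fin n) k))] : IsOreDomain (WeylAlgebra k n) :=
  isOreDomain_of_injective (weylEquiv k n) (weylEquiv k n).injective
    (fun d => ⟨1, fun h => one_ne_zero (α := diffOps k (MvPolynomial (Fin n) k))
      (by rw [← map_one (weylEquiv k n), h, map_zero]), (weylEquiv k n).symm d, by simp⟩)
    (fun d => ⟨1, fun h => one_ne_zero (α := diffOps k (MvPolynomial (Fin n) k))
      (by rw [← map_one (weylEquiv k n), h, map_zero]), (weylEquiv k n).symm d, by simp⟩)

end Weyl

/-! ### Skew fields of fractions -/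

section SkewFractions

variable {k R Q : Type*} [Field k] [Ring R] [Algebra k R] [IsOreDomain R] [DivisionRing Q]
  [Algebra k Q]

variable (k R) in
/-- The embedding of an Ore domain into its skew field of fractions, as an algebra homomorphism. -/
def skewFracOf : R →ₐ[k] SkewFrac R :=
  { (OreLocalization.numeratorRingHom : R →+* SkewFrac R) with commutes' := fun _ => rfl }

theorem skewFracOf_injective : Function.Injective (skewFracOf k R) :=
  OreLocalization.numeratorHom_inj inf_le_left

theorem skewFracOf_ne_zero {r : R} (hr : r ≠ 0) : skewFracOf k R r ≠ 0 :=
  (map_ne_zero_iff _ skewFracOf_injective).2 hr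

theorem skewFracMap_skewFracOf (φ : R ≃ₐ[k] R) (r : R) :
    skewFracMap φ (skewFracOf k R r) = skewFracOf k R (φ r) := skewFracMap_numerator φ r

variable (k) in
/-- Every element of `Frac R` is a left fraction `s⁻¹ r`. -/
theorem exists_skewFracOf_mul_eq (q : SkewFrac R) :
    ∃ s r : R, s ≠ 0 ∧ skewFracOf k R s * q = skewFracOf k R r := by
  induction q using OreLocalization.ind with
  | _ r s =>
    exact ⟨s, r, nonZeroDivisors.ne_zero s.2, OreLocalization.mul_cancel⟩

theorem skewFrac_algHom_ext {f g : SkewFrac R →ₐ[k] Q}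
    (h : ∀ r, f (skewFracOf k R r) = g (skewFracOf k R r)) : f = g := by
  ext q
  obtain ⟨s, r, hs, hq⟩ := exists_skewFracOf_mul_eq k q
  have hs' : f (skewFracOf k R s) ≠ 0 := (map_ne_zero f).2 (skewFracOf_ne_zero hs)
  refine mul_left_cancel₀ hs' ?_
  rw [← map_mul, hq, h, h, ← map_mul, hq]

/-- The extension to `Frac R` of an embedding of the Ore domain `R` into a skew field. -/
def skewFracLift (j : R →ₐ[k] Q) (hj : Function.Injective j) : SkewFrac R →ₐ[k] Q :=
  have hS : ∀ s : R⁰, j (s : R) ≠ 0 := fun s =>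
    (map_ne_zero_iff j hj).2 (nonZeroDivisors.ne_zero s.2)
  let fS : R⁰ →* Qˣ :=
    { toFun := fun s => Units.mk0 (j (s : R)) (hS s)
      map_one' := Units.ext (map_one j)
      map_mul' := fun s t => Units.ext (map_mul j (s : R) t) }
  { OreLocalization.universalHom (j : R →+* Q) fS (fun _ => rfl) with
    commutes' := fun c => (OreLocalization.universalHom_commutes (j : R →+* Q) fS (fun _ => rfl)
      (r := algebraMap k R c)).trans (j.commutes c) }

theorem skewFracLift_skewFracOf (j : R →ₐ[k] Q) (hj : Function.Injective j) (r : R) :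
    skewFracLift j hj (skewFracOf k R r) = j r :=
  OreLocalization.universalHom_commutes _ _ _

section Functoriality

variable {S : Type*} [Ring S] [Algebra k S] [IsOreDomain S]

/-- The embedding `Frac S → Frac R` induced by an embedding `S → R` of Ore domains. -/
def skewFracHom (j : S →ₐ[k] R) (hj : Function.Injective j) : SkewFrac S →ₐ[k] SkewFrac R :=
  skewFracLift ((skewFracOf k R).comp j)
    ((skewFracOf_injective (k := k) (R := R)).comp hj :
      Function.Injective ((skewFracOf k R : R → SkewFrac R) ∘ j))

theorem skewFracHom_skewFracOf (j : S →ₐ[k] R) (hj : Function.Injective j) (s : S) :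
    skewFracHom j hj (skewFracOf k S s) = skewFracOf k R (j s) :=
  skewFracLift_skewFracOf ((skewFracOf k R).comp j) _ s

theorem skewFracHom_injective (j : S →ₐ[k] R) (hj : Function.Injective j) :
    Function.Injective (skewFracHom j hj) := (skewFracHom j hj).injective

/-- A fraction `t⁻¹ b` of `R` comes from a subdomain `S` if `t` and `b` have multiples `c t`, `c b`
in `S`. -/
theorem mem_range_skewFracHom {j : S →ₐ[k] R} (hj : Function.Injective j) {q : SkewFrac R}
    {c t b : R} {v w : S} (hc : c ≠ 0) (ht : t ≠ 0)
    (hq : skewFracOf k R t * q = skewFracOf k R b) (hv : c * t = j v) (hw : c * b = j w) :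
    ∃ q' : SkewFrac S, skewFracHom j hj q' = q := by
  have hv0 : skewFracOf k R (c * t) ≠ 0 := skewFracOf_ne_zero (mul_ne_zero hc ht)
  refine ⟨(skewFracOf k S v)⁻¹ * skewFracOf k S w, ?_⟩
  rw [map_mul, map_inv₀, skewFracHom_skewFracOf, skewFracHom_skewFracOf, ← hv, ← hw,
    inv_mul_eq_iff_eq_mul₀ hv0, map_mul, map_mul, mul_assoc, hq]

theorem skewFracHom_skewFracMap {j : S →ₐ[k] R} (hj : Function.Injective j) {φ : S ≃ₐ[k] S}
    {ψ : R ≃ₐ[k] R} (h : ∀ s, j (φ s) = ψ (j s)) (q : SkewFrac S) :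
    skewFracHom j hj (skewFracMap φ q) = skewFracMap ψ (skewFracHom j hj q) := by
  have : (skewFracHom j hj).comp (skewFracMap φ) = (skewFracMap ψ).comp (skewFracHom j hj) :=
    skewFrac_algHom_ext fun s => by
      rw [AlgHom.comp_apply, AlgHom.comp_apply, skewFracMap_skewFracOf, skewFracHom_skewFracOf,
        skewFracHom_skewFracOf, skewFracMap_skewFracOf, h]
  exact congrArg (· q) (congrArg DFunLike.coe this)

theorem skewFracMap_skewFracHom {j : S →ₐ[k] R} (hj : Function.Injective j) {ψ : R ≃ₐ[k] R}
    (h : ∀ s, ψ (j s) = j s) (q : SkewFrac S) :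
    skewFracMap ψ (skewFracHom j hj q) = skewFracHom j hj q := by
  have : (skewFracMap ψ).comp (skewFracHom j hj) = skewFracHom j hj :=
    skewFrac_algHom_ext fun s => by
      rw [AlgHom.comp_apply, skewFracHom_skewFracOf, skewFracMap_skewFracOf, h]
  exact congrArg (· q) (congrArg DFunLike.coe this)

theorem skewFracOf_mul_mul (c : R) {q : SkewFrac R} {s r : R}
    (h : skewFracOf k R s * q = skewFracOf k R r) :
    skewFracOf k R (c * s) * q = skewFracOf k R (c * r) := by
  rw [map_mul, map_mul, mul_assoc, h]

end Functoriality

end SkewFractions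

/-! ### Conjugation and traces of differential operators -/

section Conjugation

variable {k K : Type*} [Field k] [Field K] [Algebra k K]

theorem diffOpsConj_mulOp (σ : K ≃ₐ[k] K) (c : K) :
    diffOpsConj σ (mulOp k c) = mulOp k (σ c) := diffOps_ext fun z => by
  rw [diffOpsConj_apply, mulOp_apply, mulOp_apply, map_mul, σ.apply_symm_apply]

/-- An automorphism fixing the coordinates fixes the partial derivatives, which are determined by
their values on the coordinates. -/
theorem IsDualCoordinates.diffOpsConj_derOp {ι : Type*} [DecidableEq ι] {x : ι → K}
    {y : ι → Derivation k K K} (h : IsDualCoordinates x y) {σ : K ≃ₐ[k] K}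
    (hσ : ∀ i, σ (x i) = x i) (i : ι) : diffOpsConj σ (derOp (y i)) = derOp (y i) := by
  let D : Derivation k K K := Derivation.mk'
    (σ.toLinearMap ∘ₗ (y i : K →ₗ[k] K) ∘ₗ σ.symm.toLinearMap) fun a b => by
      change σ (y i (σ.symm (a * b))) = a * σ (y i (σ.symm b)) + b * σ (y i (σ.symm a))
      rw [map_mul, Derivation.leibniz, map_add, smul_eq_mul, smul_eq_mul, map_mul, map_mul,
        σ.apply_symm_apply, σ.apply_symm_apply]
  have hD : D = y i := h.ext fun j => by
    change σ (y i (σ.symm (x j))) = y i (x j)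
    rw [(AlgEquiv.symm_apply_eq σ).2 (hσ j).symm, h.apply_eq]
    split_ifs <;> simp
  refine diffOps_ext fun z => ?_
  rw [diffOpsConj_apply, derOp_apply, derOp_apply]
  exact Derivation.congr_fun hD z

/-- The trace `∑ σ, σ ∘ e ∘ σ⁻¹` of a differential operator over a finite group of field
automorphisms. -/
def diffOpsTrace (Γ : Subgroup (K ≃ₐ[k] K)) [Fintype Γ] : diffOps k K →ₗ[k] diffOps k K :=
  ∑ σ : Γ, (diffOpsConj (σ : K ≃ₐ[k] K)).toLinearMap

variable {Γ : Subgroup (K ≃ₐ[k] K)} [Fintype Γ]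

theorem diffOpsTrace_eq (e : diffOps k K) :
    diffOpsTrace Γ e = ∑ σ : Γ, diffOpsConj (σ : K ≃ₐ[k] K) e := by
  simp [diffOpsTrace]

/-- The trace is linear over invariant operators. -/
theorem diffOpsTrace_mul {e f : diffOps k K}
    (hf : ∀ σ ∈ Γ, diffOpsConj σ f = f) : diffOpsTrace Γ (e * f) = diffOpsTrace Γ e * f := by
  rw [diffOpsTrace_eq, diffOpsTrace_eq, Finset.sum_mul]
  exact Finset.sum_congr rfl fun σ _ => by rw [map_mul, hf σ σ.2]

/-- By independence of characters, every nonzero operator has a multiple with nonzero trace. -/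
theorem exists_diffOpsTrace_ne_zero {e : diffOps k K} (he : e ≠ 0) :
    ∃ c : K, diffOpsTrace Γ (mulOp k c * e) ≠ 0 := by
  by_contra! hcon
  refine he (diffOps_ext fun z => ?_)
  have hinj : Function.Injective fun σ : Γ => ((σ : K ≃ₐ[k] K) : K →* K) := fun σ τ h =>
    Subtype.ext (AlgEquiv.ext fun a => DFunLike.congr_fun h a)
  have hli := (linearIndependent_monoidHom K K).comp _ hinj
  rw [Fintype.linearIndependent_iff] at hli
  have := hli (fun σ => (diffOpsConj (σ : K ≃ₐ[k] K) e : Module.End k K) z) (funext fun c => by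
    have h := LinearMap.congr_fun (congrArg Subtype.val (hcon c)) z
    rw [diffOpsTrace_eq, AddSubmonoidClass.coe_finsetSum, LinearMap.sum_apply] at h
    rw [Finset.sum_apply]
    refine Eq.trans (Finset.sum_congr rfl fun σ _ => ?_) h
    rw [map_mul, diffOpsConj_mulOp, mulOp_mul_apply]
    exact mul_comm _ _) 1
  exact this

end Conjugation

/-! ### Invariant fractions of differential operators -/

section Invariants

variable {k K : Type*} [Field k] [Field K] [Algebra k K] {n : ℕ} {x : Fin n → K}
  {y : Fin n → Derivation k K K} {Γ : Subgroup (K ≃ₐ[k] K)}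
  {φ : MvPolynomial (Fin n) k →ₐ[k] K}

theorem IsDualCoordinates.weylLift_weylPoly (h : IsDualCoordinates x y)
    (hφ : ∀ i, φ (MvPolynomial.X i) = x i) (p : MvPolynomial (Fin n) k) :
    h.isCanonicalPair.weylLift (k := k) (weylPoly p) = mulOp k (φ p) := by
  have : (h.isCanonicalPair.weylLift (k := k)).comp weylPoly = (mulOp k).comp φ :=
    MvPolynomial.algHom_ext fun i => by
      rw [AlgHom.comp_apply, weylPoly_X, h.isCanonicalPair.weylLift_x, AlgHom.comp_apply, hφ]
  exact congrArg (· p) (congrArg DFunLike.coe this)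

theorem IsDualCoordinates.weylLift_injective [CharZero k] (h : IsDualCoordinates x y)
    (hφ : ∀ i, φ (MvPolynomial.X i) = x i) (hinj : Function.Injective φ) :
    Function.Injective (h.isCanonicalPair.weylLift (k := k)) :=
  h.isCanonicalPair.weylLift_injective (φ := (mulOp k).comp φ)
    (fun i => by rw [AlgHom.comp_apply, hφ]) (mulOp_injective.comp hinj)

theorem IsDualCoordinates.diffOpsConj_weylLift (h : IsDualCoordinates x y)
    {σ : K ≃ₐ[k] K} (hσ : ∀ i, σ (x i) = x i) (w : WeylAlgebra k n) :
    diffOpsConj σ (h.isCanonicalPair.weylLift w) = h.isCanonicalPair.weylLift w := by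
  refine weyl_induction (S := AlgHom.equalizer
    (((diffOpsConj σ : diffOps k K →ₐ[k] diffOps k K)).comp h.isCanonicalPair.weylLift)
    h.isCanonicalPair.weylLift) (fun i => ?_) (fun i => ?_) w
  · change diffOpsConj σ (h.isCanonicalPair.weylLift _) = h.isCanonicalPair.weylLift _
    rw [h.isCanonicalPair.weylLift_x, diffOpsConj_mulOp, hσ]
  · change diffOpsConj σ (h.isCanonicalPair.weylLift _) = h.isCanonicalPair.weylLift _
    rw [h.isCanonicalPair.weylLift_d, h.diffOpsConj_derOp hσ]

/-- Traces of differential operators over a group fixing the coordinates `x_i` lie in the Weyl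
algebra, up to a polynomial denominator. Since the `∂_i` are invariant, the trace only affects the
coefficients of an operator, and moves them into the fixed field. -/
theorem IsDualCoordinates.exists_mul_diffOpsTrace_eq [CharZero k] [Fintype Γ]
    (h : IsDualCoordinates x y) (hφ : ∀ i, φ (MvPolynomial.X i) = x i)
    (hfix : ∀ σ ∈ Γ, ∀ i, σ (x i) = x i)
    (hinv : ∀ z : K, (∀ σ ∈ Γ, σ z = z) → ∃ p p', p ≠ 0 ∧ φ p * z = φ p') (e : diffOps k K) :
    ∃ p : MvPolynomial (Fin n) k, p ≠ 0 ∧ ∃ w : WeylAlgebra k n,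
      mulOp k (φ p) * diffOpsTrace Γ e = h.isCanonicalPair.weylLift w := by
  let B : Submodule k (diffOps k K) :=
    { carrier := {e | ∃ p : MvPolynomial (Fin n) k, p ≠ 0 ∧ ∃ w : WeylAlgebra k n,
        mulOp k (φ p) * e = h.isCanonicalPair.weylLift w}
      add_mem' := by
        rintro e f ⟨p, hp, v, hv⟩ ⟨q, hq, w, hw⟩
        refine ⟨p * q, mul_ne_zero hp hq, weylPoly q * v + weylPoly p * w, ?_⟩
        rw [map_add, map_mul h.isCanonicalPair.weylLift, map_mul h.isCanonicalPair.weylLift,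
          h.weylLift_weylPoly hφ, h.weylLift_weylPoly hφ, ← hv, ← hw, mul_add, ← mul_assoc,
          ← mul_assoc, ← map_mul, ← map_mul, ← map_mul, ← map_mul, mul_comm q]
      zero_mem' := ⟨1, one_ne_zero, 0, by rw [mul_zero, map_zero]⟩
      smul_mem' := by
        rintro c e ⟨p, hp, w, hw⟩
        exact ⟨p, hp, c • w, by rw [mul_smul_comm, hw, map_smul]⟩ }
  obtain ⟨m, hm⟩ := exists_mem_xOrderLE (k := k) x e
  refine h.isCanonicalPair.xOrderLE_le (U := fun _ => B.comap (diffOpsTrace Γ))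
    (fun _ _ _ => le_rfl) (fun d hd => ?_) (fun m u hu i => ?_) m hm
  · obtain ⟨c, rfl⟩ := exists_mulOp_eq h.eq_zero hd
    have htr : diffOpsTrace Γ (mulOp k c) = mulOp k (∑ σ : Γ, (σ : K ≃ₐ[k] K) c) := by
      rw [diffOpsTrace_eq, map_sum]
      exact Finset.sum_congr rfl fun σ _ => diffOpsConj_mulOp _ _
    obtain ⟨p, p', hp, hpp⟩ := hinv (∑ σ : Γ, (σ : K ≃ₐ[k] K) c) fun τ hτ => by
      rw [map_sum]
      exact Fintype.sum_equiv (Equiv.mulLeft (⟨τ, hτ⟩ : Γ)) _ _ fun σ => rfl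
    refine ⟨p, hp, weylPoly p', ?_⟩
    rw [htr, ← map_mul, hpp, h.weylLift_weylPoly hφ]
  · obtain ⟨p, hp, w, hw⟩ := hu
    refine ⟨p, hp, w * weylD k i, ?_⟩
    rw [diffOpsTrace_mul fun σ hσ => h.diffOpsConj_derOp (hfix σ hσ) i, ← mul_assoc, hw, map_mul,
      h.isCanonicalPair.weylLift_d]

/-- A fraction `s⁻¹ r` which is invariant under `Γ` equals `(tr s)⁻¹ tr r`. -/
theorem skewFracOf_diffOpsTrace_mul [Fintype Γ] [IsOreDomain (diffOps k K)]
    {q : SkewFrac (diffOps k K)}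
    (hq : ∀ σ : Γ, skewFracMap (k := k) (diffOpsConj (σ : K ≃ₐ[k] K)) q = q) {s r : diffOps k K}
    (h : skewFracOf k (diffOps k K) s * q = skewFracOf k (diffOps k K) r) :
    skewFracOf k (diffOps k K) (diffOpsTrace Γ s) * q =
      skewFracOf k (diffOps k K) (diffOpsTrace Γ r) := by
  rw [diffOpsTrace_eq, diffOpsTrace_eq, map_sum, map_sum, Finset.sum_mul]
  refine Finset.sum_congr rfl fun i _ => ?_
  rw [← skewFracMap_skewFracOf, ← skewFracMap_skewFracOf, ← h, map_mul, hq]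

/-- Two traces are brought into the Weyl algebra by a common polynomial factor. -/
theorem IsDualCoordinates.exists_mul_diffOpsTrace_eq_and [CharZero k] [Fintype Γ]
    (h : IsDualCoordinates x y) (hφ : ∀ i, φ (MvPolynomial.X i) = x i)
    (hinj : Function.Injective φ) (hfix : ∀ σ ∈ Γ, ∀ i, σ (x i) = x i)
    (hinv : ∀ z : K, (∀ σ ∈ Γ, σ z = z) → ∃ p p', p ≠ 0 ∧ φ p * z = φ p') (e f : diffOps k K) :
    ∃ c : diffOps k K, c ≠ 0 ∧ ∃ v w : WeylAlgebra k n,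
      c * diffOpsTrace Γ e = h.isCanonicalPair.weylLift v ∧
        c * diffOpsTrace Γ f = h.isCanonicalPair.weylLift w := by
  obtain ⟨p, hp, v, hv⟩ := h.exists_mul_diffOpsTrace_eq hφ hfix hinv e
  obtain ⟨p', hp', w, hw⟩ := h.exists_mul_diffOpsTrace_eq hφ hfix hinv f
  refine ⟨mulOp k (φ (p' * p)), fun h0 => ?_, weylPoly p' * v, weylPoly p * w, ?_, ?_⟩
  · rw [← map_zero (mulOp k), mulOp_injective.eq_iff, ← map_zero φ, hinj.eq_iff] at h0
    exact mul_ne_zero hp' hp h0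
  · rw [map_mul, map_mul, mul_assoc, hv, map_mul, h.weylLift_weylPoly hφ]
  · rw [mul_comm p', map_mul, map_mul, mul_assoc, hw, map_mul, h.weylLift_weylPoly hφ]

/-- Over a field with dual coordinates fixed by a finite group `Γ`, whose fixed field is generated
by the coordinates, the invariants of `Frac D(K)` are the Weyl field. -/
theorem IsDualCoordinates.exists_skewFracHom_eq_iff [CharZero k] [Finite Γ]
    [IsOreDomain (diffOps k K)] [IsOreDomain (WeylAlgebra k n)] (h : IsDualCoordinates x y)
    (hφ : ∀ i, φ (MvPolynomial.X i) = x i) (hinj : Function.Injective φ)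
    (hfix : ∀ σ ∈ Γ, ∀ i, σ (x i) = x i)
    (hinv : ∀ z : K, (∀ σ ∈ Γ, σ z = z) → ∃ p p', p ≠ 0 ∧ φ p * z = φ p')
    (q : SkewFrac (diffOps k K)) :
    (∃ v, skewFracHom h.isCanonicalPair.weylLift (h.weylLift_injective hφ hinj) v = q) ↔
      ∀ σ : Γ, skewFracMap (k := k) (diffOpsConj (σ : K ≃ₐ[k] K)) q = q := by
  have := Fintype.ofFinite Γ
  constructor
  · rintro ⟨v, rfl⟩ σ
    exact skewFracMap_skewFracHom _ (h.diffOpsConj_weylLift (hfix σ σ.2)) v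
  · intro hq
    obtain ⟨s, r, hs, hsr⟩ := exists_skewFracOf_mul_eq k q
    -- The multiplier `a` keeps the trace of the denominator from vanishing.
    obtain ⟨a, ha⟩ := exists_diffOpsTrace_ne_zero (Γ := Γ) hs
    obtain ⟨c, hc, v, w, hv, hw⟩ := h.exists_mul_diffOpsTrace_eq_and hφ hinj hfix hinv
      (mulOp k a * s) (mulOp k a * r)
    exact mem_range_skewFracHom _ hc ha
      (skewFracOf_diffOpsTrace_mul hq (skewFracOf_mul_mul _ hsr)) hv hw

end Invariants

/-! ### Existence of coordinates -/

section Coordinates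

/-- Over a field of characteristic zero, an algebraic extension of a field of rational functions has
dual coordinates: it is formally étale over the polynomial ring, so the differentials of the
variables form a basis of its Kähler differentials. -/
theorem exists_isDualCoordinates {k ι L K : Type*} [Field k] [CharZero k] [DecidableEq ι] [Field L]
    [Field K] [Algebra k L] [Algebra k K] [Algebra (MvPolynomial ι k) L]
    [Algebra (MvPolynomial ι k) K] [Algebra L K] [IsScalarTower k (MvPolynomial ι k) L]
    [IsScalarTower k (MvPolynomial ι k) K] [IsScalarTower (MvPolynomial ι k) L K]
    [IsFractionRing (MvPolynomial ι k) L] [Algebra.IsAlgebraic L K] :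
    ∃ y : ι → Derivation k K K,
      IsDualCoordinates (fun i => algebraMap (MvPolynomial ι k) K (MvPolynomial.X i)) y := by
  have : CharZero L := charZero_of_injective_algebraMap (algebraMap k L).injective
  have : Algebra.FormallyEtale L K := Algebra.FormallyEtale.of_isSeparable L K
  have : Algebra.FormallyEtale (MvPolynomial ι k) L :=
    Algebra.FormallyEtale.of_isLocalization (MvPolynomial ι k)⁰
  have : Algebra.FormallyEtale (MvPolynomial ι k) K := Algebra.FormallyEtale.comp _ L K
  let b : Module.Basis ι K Ω[K⁄k] := ((KaehlerDifferential.mvPolynomialBasis k ι).baseChange K).map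
    (KaehlerDifferential.tensorKaehlerEquivOfFormallyEtale k (MvPolynomial ι k) K)
  have hb : ∀ i, b i = KaehlerDifferential.D k K
      (algebraMap (MvPolynomial ι k) K (MvPolynomial.X i)) := fun i => by
    simp only [b, Module.Basis.map_apply, Module.Basis.baseChange_apply,
      KaehlerDifferential.mvPolynomialBasis_apply]
    rw [LinearEquiv.eq_symm_apply .. |>.1
      (KaehlerDifferential.tensorKaehlerEquivOfFormallyEtale_symm_D_algebraMap k
        (MvPolynomial ι k) K (MvPolynomial.X i)).symm]
  refine ⟨fun i => (b.coord i).compDer (KaehlerDifferential.D k K), fun i j => ?_, fun D hD => ?_⟩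
  · change b.coord i (KaehlerDifferential.D k K _) = _
    rw [← hb, Module.Basis.coord_apply, Module.Basis.repr_self, Finsupp.single_apply]
    simp only [eq_comm]
  · have h0 : D.liftKaehlerDifferential = 0 := b.ext fun i => by
      rw [hb, Derivation.liftKaehlerDifferential_comp_D, hD, LinearMap.zero_apply]
    rw [← Derivation.liftKaehlerDifferential_comp D, h0]
    ext
    simp

end Coordinates

/-! ### Dimension and transcendence degree -/

section Dimension

/-- Incomparability gives one inequality; going up and lying over give the other. -/
theorem ringKrullDim_eq_of_isIntegral {R S : Type*} [CommRing R] [CommRing S] [Algebra R S]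
    [Algebra.IsIntegral R S] [FaithfulSMul R S] : ringKrullDim S = ringKrullDim R := by
  refine le_antisymm ?_ ?_
  · refine Order.krullDim_le_of_strictMono (PrimeSpectrum.comap (algebraMap R S)) fun I J h => ?_
    exact Ideal.IsIntegral.comap_lt_comap (I := I.asIdeal) (J := J.asIdeal) h
  · refine iSup_le fun l => ?_
    obtain ⟨P, -, hP, hPl⟩ := Ideal.exists_ideal_over_prime_of_isIntegral (S := S)
      (RelSeries.head l).asIdeal ⊥ (by
        rw [← RingHom.ker_eq_comap_bot, (RingHom.injective_iff_ker_eq_bot _).1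
          (FaithfulSMul.algebraMap_injective R S)]
        exact bot_le)
    have : P.LiesOver (RelSeries.head l).asIdeal := ⟨hPl.symm⟩
    have : Algebra.HasGoingUp R S := Algebra.HasGoingUp.of_isIntegral
    obtain ⟨l', hl', -⟩ := Ideal.exists_ltSeries_of_hasGoingUp l P
    rw [← hl']
    exact le_iSup (fun p : LTSeries (PrimeSpectrum S) => (p.length : WithBot ℕ∞)) l'

theorem trdeg_eq_of_isAlgebraic_mvPolynomial {k A : Type*} [Field k] [CommRing A] [IsDomain A]
    [Algebra k A] (m : ℕ) [Algebra (MvPolynomial (Fin m) k) A]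
    [IsScalarTower k (MvPolynomial (Fin m) k) A] [FaithfulSMul (MvPolynomial (Fin m) k) A]
    [Algebra.IsAlgebraic (MvPolynomial (Fin m) k) A] : Algebra.trdeg k A = m := by
  have h := lift_trdeg_add_eq k (MvPolynomial (Fin m) k) A
  rw [trdeg_eq_zero (R := MvPolynomial (Fin m) k), MvPolynomial.trdeg_of_isDomain] at h
  simpa using h.symm

/-- The dimension of a finitely generated domain `A` is the transcendence degree of its fraction
field, by Noether normalization. -/
theorem ringKrullDim_eq_of_isAlgebraic {k A K : Type*} [Field k] [CommRing A] [IsDomain A]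
    [Algebra k A] [Algebra.FiniteType k A] [Field K] [Algebra k K] [Algebra A K]
    [IsFractionRing A K] [IsScalarTower k A K] (m : ℕ) [Algebra (MvPolynomial (Fin m) k) K]
    [IsScalarTower k (MvPolynomial (Fin m) k) K] [FaithfulSMul (MvPolynomial (Fin m) k) K]
    [Algebra.IsAlgebraic (MvPolynomial (Fin m) k) K] : ringKrullDim A = m := by
  obtain ⟨s, g, hg, hgi⟩ := exists_integral_inj_algHom_of_fg k A
  let _ : Algebra (MvPolynomial (Fin s) k) A := g.toAlgebra
  have : IsScalarTower k (MvPolynomial (Fin s) k) A := IsScalarTower.of_algHom g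
  have : FaithfulSMul (MvPolynomial (Fin s) k) A := (faithfulSMul_iff_algebraMap_injective _ _).2 hg
  have : Algebra.IsIntegral (MvPolynomial (Fin s) k) A := ⟨hgi⟩
  have : FaithfulSMul k A := (faithfulSMul_iff_algebraMap_injective _ _).2
    (algebraMap k A).injective
  have hA : Algebra.trdeg k A = s := trdeg_eq_of_isAlgebraic_mvPolynomial s
  have hK : Algebra.trdeg k K = m := trdeg_eq_of_isAlgebraic_mvPolynomial m
  have hAK := lift_trdeg_add_eq k A K
  have : Algebra.IsAlgebraic A K := IsLocalization.isAlgebraic K A⁰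
  rw [hA, hK, trdeg_eq_zero (R := A), Cardinal.lift_zero, add_zero, Cardinal.lift_natCast,
    Cardinal.lift_natCast, Nat.cast_inj] at hAK
  rw [ringKrullDim_eq_of_isIntegral (R := MvPolynomial (Fin s) k), ← hAK,
    MvPolynomial.ringKrullDim_of_isNoetherianRing, ringKrullDim_eq_zero_of_field, zero_add,
    Nat.card_fin]

end Dimension

/-! ### Passage from the ring to its fraction field -/

section Transfer

variable {k A K : Type*} [Field k] [CommRing A] [IsDomain A] [Algebra k A] [Field K] [Algebra k K]
  [Algebra A K] [IsFractionRing A K] [IsScalarTower k A K]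

theorem diffOpsExtend_diffOpsConj {σ : A ≃ₐ[k] A} {τ : K ≃ₐ[k] K}
    (h : ∀ a, algebraMap A K (σ a) = τ (algebraMap A K a)) (d : diffOps k A) :
    diffOpsExtend k A K (diffOpsConj σ d) = diffOpsConj τ (diffOpsExtend k A K d) := by
  refine diffOps_ext_of_algebraMap (A := A) fun a => ?_
  have hs : τ.symm (algebraMap A K a) = algebraMap A K (σ.symm a) := by
    rw [AlgEquiv.symm_apply_eq, ← h, σ.apply_symm_apply]
  rw [diffOpsExtend_apply, diffOpsConj_apply, diffOpsConj_apply, hs, diffOpsExtend_apply, h]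

variable [Algebra.FiniteType k A] [IsOreDomain (diffOps k A)] [IsOreDomain (diffOps k K)]

variable (k A K) in
/-- The canonical homomorphism `Frac D(A) → Frac D(K)`, for `K` the fraction field of `A`. -/
def skewFracDiffOpsExtend : SkewFrac (diffOps k A) →ₐ[k] SkewFrac (diffOps k K) :=
  skewFracHom (diffOpsExtend k A K) diffOpsExtend_injective

theorem skewFracDiffOpsExtend_surjective :
    Function.Surjective (skewFracDiffOpsExtend k A K) := fun q => by
  obtain ⟨s, r, hs, hq⟩ := exists_skewFracOf_mul_eq k q
  obtain ⟨f, hf, d, hd⟩ := exists_mulOp_mul_eq_diffOpsExtend (A := A) s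
  obtain ⟨g, hg, e, he⟩ := exists_mulOp_mul_eq_diffOpsExtend (A := A) r
  refine mem_range_skewFracHom (c := mulOp k (algebraMap A K (f * g)))
    (v := mulOp k g * d) (w := mulOp k f * e) _ (fun h0 => ?_) hs hq ?_ ?_
  · rw [← map_zero (mulOp k), mulOp_injective.eq_iff, map_mul] at h0
    exact mul_ne_zero hf hg h0
  · rw [map_mul (diffOpsExtend k A K), diffOpsExtend_mulOp, ← hd, mul_comm f,
      map_mul (algebraMap A K), map_mul, mul_assoc]
  · rw [map_mul (diffOpsExtend k A K), diffOpsExtend_mulOp, ← he, map_mul (algebraMap A K), map_mul,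
      mul_assoc]

/-- If the fixed field of a finite group `G` acting on the fraction field `K` of `A` is a field of
rational functions whose variables are dual coordinates on `K`, then the invariants of `Frac D(A)`
are the Weyl field. -/
theorem nonempty_fracDiffOpsInvariants_algEquiv_weylField [CharZero k] {n : ℕ}
    [IsOreDomain (WeylAlgebra k n)] {G : Type*} [Group G] [Finite G] [MulSemiringAction G A]
    [SMulCommClass G k A] [MulSemiringAction G K] [SMulCommClass G k K] [SMulDistribClass G A K]
    {φ : MvPolynomial (Fin n) k →ₐ[k] K} {y : Fin n → Derivation k K K}
    (h : IsDualCoordinates (fun i => φ (MvPolynomial.X i)) y) (hinj : Function.Injective φ)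
    (hfix : ∀ (g : G) (i : Fin n), g • φ (MvPolynomial.X i) = φ (MvPolynomial.X i))
    (hinv : ∀ z : K, (∀ g : G, g • z = z) → ∃ p p', p ≠ 0 ∧ φ p * z = φ p') :
    Nonempty (fracDiffOpsInvariants k A G ≃ₐ[k] WeylField k n) := by
  let Γ : Subgroup (K ≃ₐ[k] K) := (MulSemiringAction.toAlgAut G k K).range
  have : Finite Γ :=
    Finite.of_surjective _ (MulSemiringAction.toAlgAut G k K).rangeRestrict_surjective
  have hΓ : ∀ {z : K}, (∀ σ ∈ Γ, σ z = z) ↔ ∀ g : G, g • z = z := fun {z} =>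
    ⟨fun H g => H _ ⟨g, rfl⟩, fun H σ ⟨g, hg⟩ => hg ▸ H g⟩
  let α := skewFracDiffOpsExtend k A K
  let β : WeylField k n →ₐ[k] SkewFrac (diffOps k K) :=
    skewFracHom h.isCanonicalPair.weylLift (h.weylLift_injective (fun _ => rfl) hinj)
  have hα : Function.Injective α := skewFracHom_injective _ _
  have hβ : Function.Injective β := skewFracHom_injective _ _
  have hαg : ∀ (g : G) (q : SkewFrac (diffOps k A)),
      α (skewFracMap (diffOpsConj (MulSemiringAction.toAlgEquiv k A g)) q) =
        skewFracMap (diffOpsConj (MulSemiringAction.toAlgEquiv k K g)) (α q) := fun g q =>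
    skewFracHom_skewFracMap _
      (diffOpsExtend_diffOpsConj fun a => algebraMap.coe_smul' g a K) q
  have hmap : (fracDiffOpsInvariants k A G).map α = β.range := by
    ext q
    obtain ⟨q, rfl⟩ := skewFracDiffOpsExtend_surjective (A := A) q
    refine Iff.trans ?_ (h.exists_skewFracHom_eq_iff (Γ := Γ) (fun _ => rfl) hinj
      (fun σ hσ i => hΓ.2 (fun g => hfix g i) σ hσ) (fun z hz => hinv z (hΓ.1 hz)) (α q)).symm
    constructor
    · rintro ⟨q', hq', hqq⟩ ⟨_, g, rfl⟩
      rw [← hα hqq]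
      exact (hαg g q').symm.trans (congrArg α ((mem_fracDiffOpsInvariants k A G _).1 hq' g))
    · refine fun hq => ⟨q, (mem_fracDiffOpsInvariants k A G q).2 fun g => hα ?_, rfl⟩
      exact (hαg g q).trans (hq ⟨_, g, rfl⟩)
  exact ⟨((fracDiffOpsInvariants k A G).equivMapOfInjective α hα).trans
    ((Subalgebra.equivOfEq _ _ hmap).trans (AlgEquiv.ofInjective β hβ).symm)⟩

end Transfer

/-! ### Rational quotients -/

theorem isOreDomain_weylAlgebra_of_charZero (k : Type*) [Field k] [CharZero k] (n : ℕ) :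
    IsOreDomain (WeylAlgebra k n) := by
  obtain ⟨y, hy⟩ := exists_isDualCoordinates (k := k) (ι := Fin n)
    (L := FractionRing (MvPolynomial (Fin n) k)) (K := FractionRing (MvPolynomial (Fin n) k))
  have := hy.isOreDomain_diffOps
  have : IsOreDomain (diffOps k (MvPolynomial (Fin n) k)) :=
    isOreDomain_diffOps_of_fractionField (K := FractionRing (MvPolynomial (Fin n) k))
  exact isOreDomain_weylAlgebra k n

/-- The case where the fixed field `L` of `G` on the fraction field `K` of `A` is given as the
fraction field of a polynomial ring. -/
theorem exists_isOreDomain_and_algEquiv_weylField {k A K L G : Type*} [Field k] [CharZero k]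
    [CommRing A] [IsDomain A] [Algebra k A] [Algebra.FiniteType k A] [Field K] [Algebra k K]
    [Algebra A K] [IsFractionRing A K] [IsScalarTower k A K] [Group G] [Finite G]
    [MulSemiringAction G A] [SMulCommClass G k A] [MulSemiringAction G K] [SMulCommClass G k K]
    [SMulDistribClass G A K] {m : ℕ} [Field L] [Algebra k L] [Algebra L K]
    [Algebra.IsInvariant L K G] [SMulCommClass G L K] [Algebra (MvPolynomial (Fin m) k) L]
    [Algebra (MvPolynomial (Fin m) k) K] [IsScalarTower k (MvPolynomial (Fin m) k) L]
    [IsScalarTower k (MvPolynomial (Fin m) k) K] [IsScalarTower (MvPolynomial (Fin m) k) L K]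
    [IsFractionRing (MvPolynomial (Fin m) k) L] (n : ℕ) (hn : ringKrullDim A = n) :
    ∃ (_ : IsOreDomain (diffOps k A)) (_ : IsOreDomain (WeylAlgebra k n)),
      Nonempty (fracDiffOpsInvariants k A G ≃ₐ[k] WeylField k n) := by
  have : Algebra.IsIntegral L K := Algebra.IsInvariant.isIntegral L K G
  have : Algebra.IsAlgebraic (MvPolynomial (Fin m) k) K :=
    IsFractionRing.comap_isAlgebraic_iff (K := L).2 inferInstance
  have hinj : Function.Injective (algebraMap (MvPolynomial (Fin m) k) K) := by
    rw [IsScalarTower.algebraMap_eq _ L K]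
    exact (algebraMap L K).injective.comp (IsFractionRing.injective _ L)
  have : FaithfulSMul (MvPolynomial (Fin m) k) K :=
    (faithfulSMul_iff_algebraMap_injective _ _).2 hinj
  obtain rfl : n = m := by
    have h := hn.symm.trans (ringKrullDim_eq_of_isAlgebraic (k := k) (A := A) (K := K) m)
    exact_mod_cast h
  obtain ⟨y, hy⟩ := exists_isDualCoordinates (k := k) (ι := Fin n) (L := L) (K := K)
  have := hy.isOreDomain_diffOps
  have hA : IsOreDomain (diffOps k A) := isOreDomain_diffOps_of_fractionField (K := K)
  have hW := isOreDomain_weylAlgebra_of_charZero k n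
  refine ⟨hA, hW, nonempty_fracDiffOpsInvariants_algEquiv_weylField
    (φ := IsScalarTower.toAlgHom k (MvPolynomial (Fin n) k) K) hy hinj (fun g i => ?_)
    fun z hz => ?_⟩
  · change g • algebraMap (MvPolynomial (Fin n) k) K _ = algebraMap (MvPolynomial (Fin n) k) K _
    rw [IsScalarTower.algebraMap_apply _ L K, smul_algebraMap]
  · obtain ⟨l, rfl⟩ := Algebra.IsInvariant.isInvariant (A := L) (G := G) z hz
    obtain ⟨p', p, hp, rfl⟩ := IsFractionRing.div_surjective (MvPolynomial (Fin n) k) l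
    refine ⟨p, p', nonZeroDivisors.ne_zero hp, ?_⟩
    change algebraMap (MvPolynomial (Fin n) k) K p * _ = algebraMap (MvPolynomial (Fin n) k) K p'
    rw [IsScalarTower.algebraMap_apply _ L K p, IsScalarTower.algebraMap_apply _ L K p', ← map_mul,
      mul_div_cancel₀]
    exact IsFractionRing.to_map_ne_zero_of_mem_nonZeroDivisors hp

/-- The case where the fixed field `L` of `G` on the fraction field `K` of `A` is given with an
isomorphism to a field of rational functions, through which it becomes a fraction field of the
polynomial ring. -/
theorem exists_isOreDomain_and_algEquiv_weylField_of_algEquiv {k A K L G : Type*} [Field k]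
    [CharZero k] [CommRing A] [IsDomain A] [Algebra k A] [Algebra.FiniteType k A] [Field K]
    [Algebra k K] [Algebra A K] [IsFractionRing A K] [IsScalarTower k A K] [Group G] [Finite G]
    [MulSemiringAction G A] [SMulCommClass G k A] [MulSemiringAction G K] [SMulDistribClass G A K]
    [Field L] [Algebra k L] [Algebra L K] [IsScalarTower k L K] [Algebra.IsInvariant L K G]
    [SMulCommClass G L K] {m : ℕ} (e : L ≃ₐ[k] FractionRing (MvPolynomial (Fin m) k))
    (n : ℕ) (hn : ringKrullDim A = n) :
    ∃ (_ : IsOreDomain (diffOps k A)) (_ : IsOreDomain (WeylAlgebra k n)),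
      Nonempty (fracDiffOpsInvariants k A G ≃ₐ[k] WeylField k n) := by
  have : SMulCommClass G k K := ⟨fun g c x => by
    rw [← IsScalarTower.algebraMap_smul L c x, ← IsScalarTower.algebraMap_smul L c (g • x),
      smul_comm]⟩
  let f : MvPolynomial (Fin m) k →ₐ[k] L :=
    (e.symm : FractionRing (MvPolynomial (Fin m) k) →ₐ[k] L).comp
      (Algebra.algHom k (MvPolynomial (Fin m) k) (FractionRing (MvPolynomial (Fin m) k)))
  let _ : Algebra (MvPolynomial (Fin m) k) L := f.toAlgebra
  have : IsScalarTower k (MvPolynomial (Fin m) k) L := IsScalarTower.of_algHom f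
  let e' : FractionRing (MvPolynomial (Fin m) k) ≃ₐ[MvPolynomial (Fin m) k] L :=
    { e.symm with commutes' := fun _ => rfl }
  have : IsFractionRing (MvPolynomial (Fin m) k) L :=
    IsLocalization.isLocalization_of_algEquiv (MvPolynomial (Fin m) k)⁰ e'
  let _ : Algebra (MvPolynomial (Fin m) k) K :=
    ((IsScalarTower.toAlgHom k L K).comp f).toAlgebra
  have : IsScalarTower k (MvPolynomial (Fin m) k) K := IsScalarTower.of_algHom _
  have : IsScalarTower (MvPolynomial (Fin m) k) L K := IsScalarTower.of_algebraMap_eq fun _ => rfl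
  exact exists_isOreDomain_and_algEquiv_weylField (K := K) (L := L) (m := m) n hn

end

theorem theorem1p3 {A : Type*} [CommRing A] [IsDomain A] [Algebra ℂ A] [Algebra.FiniteType ℂ A]
    {G : Type*} [Group G] [Finite G] [MulSemiringAction G A] [SMulCommClass G ℂ A]
    (n : ℕ) (hn : ringKrullDim A = n)
    (hrat : IsRationalVariety ℂ (FixedPoints.subalgebra ℂ A G)) :
    ∃ (_ : IsOreDomain (diffOps ℂ A)) (_ : IsOreDomain (WeylAlgebra ℂ n)),
      Nonempty (fracDiffOpsInvariants ℂ A G ≃ₐ[ℂ] WeylField ℂ n) := by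
  obtain ⟨m, ⟨e⟩⟩ := hrat
  let B := FixedPoints.subalgebra ℂ A G
  let K := FractionRing A
  let L := FractionRing B
  let _ : MulSemiringAction G K := IsFractionRing.mulSemiringAction G A K
  have : SMulDistribClass G A K := IsFractionRing.smulDistribClass G A K
  have : SMulCommClass G B A := ⟨fun g b a => by
    change g • ((b : A) * a) = (b : A) * g • a
    rw [smul_mul', b.2 g]⟩
  have : Algebra.IsInvariant B A G := ⟨fun a ha => ⟨⟨a, ha⟩, rfl⟩⟩
  have : FaithfulSMul B K := (faithfulSMul_iff_algebraMap_injective _ _).2 <| by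
    rw [IsScalarTower.algebraMap_eq B A K]
    exact (IsFractionRing.injective A K).comp Subtype.val_injective
  let _ : Algebra L K := FractionRing.liftAlgebra B K
  have : IsScalarTower B L K := FractionRing.isScalarTower_liftAlgebra B K
  -- `L` is the fixed field of `G` on `K`: a fraction may be written with an invariant denominator.
  have : Algebra.IsInvariant L K G := IsFractionRing.isInvariant G B A L K
  have : SMulCommClass G L K := IsFractionRing.smulCommClass G B A L K
  have : IsScalarTower ℂ L K := IsScalarTower.of_algebraMap_eq fun c => by
    rw [IsScalarTower.algebraMap_apply ℂ B L, ← IsScalarTower.algebraMap_apply B L K,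
      ← IsScalarTower.algebraMap_apply ℂ B K]
  exact exists_isOreDomain_and_algEquiv_weylField_of_algEquiv (K := K) (L := L) e n hn
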